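/- All $C^*$-algebras are unital, $\otimes$ denotes the spatial (minimal) tensor product, and morphisms are unital $*$-homomorphisms. A *compact quantum group* is a $C^*$-algebra $A$ with a unital $*$-homomorphism $\Delta:A\to A\otimes A$ such that $(\Delta\otimes\mathrm{id})\Delta=(\mathrm{id}\otimes\Delta)\Delta$ and such that both $(1\otimes A)\Delta(A)$ and $(A\otimes 1)\Delta(A)$ span dense subspaces of $A\otimes A$. Its *Haar state* is the state $h_A$ with $(h_A\otimes\mathrm{id})\Delta(a)=(\mathrm{id}\otimes h_A)\Delta(a)=h_A(a)1$ for all $a\in A$. A *quantum subgroup* of $(A,\Delta)$ is a pair $(B,j)$ of a compact quantum group $(B,\Delta_B)$ and a surjective unital $*$-homomorphism $j:A\to B$ with $\Delta_B\circ j=(j\otimes j)\circ\Delta$. A state $\varphi$ on $A$ is *idempotent* if $(\varphi\otimes\varphi)\circ\Delta=\varphi$, and it is a *Haar idempotent* if $\varphi=h_B\circ j$ for some quantum subgroup $(B,j)$ of $A$. A state $\psi$ is *faithful* if $\psi(a^*a)=0$ implies $a=0$. **Theorem.** Let $(A,\Delta)$ be a compact quantum group, let $\varphi$ be an idempotent state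 on $A$ and let $N_\varphi=\{a\in A:\varphi(a^*a)=0\}$. Then $N_\varphi$ is a left ideal of $A$, and the following are equivalent: 1. $\varphi$ is a Haar idempotent; 2. $N_\varphi$ is a two-sided ideal of $A$; 3. $N_\varphi$ is selfadjoint, i.e. $a\in N_\varphi$ implies $a^*\in N_\varphi$. In that case let $\pi_\varphi:A\to A/N_\varphi$ be the quotient map onto the quotient $C^*$-algebra. There is a coproduct $\Delta_\varphi$ on $A/N_\varphi$ with $\Delta_\varphi\circ\pi_\varphi=(\pi_\varphi\otimes\pi_\varphi)\circ\Delta$; with it $A/N_\varphi$ is a compact quantum group, so that $(A/N_\varphi,\pi_\varphi)$ is a quantum subgroup of $A$; its Haar state $h$ is faithful and $\varphi=h\circ\pi_\varphi$. Moreover, if $(B,j)$ is any quantum subgroup of $A$ with faithful Haar state $h_B$ and $\varphi=h_B\circ j$, then there is a $*$-isomorphism $\Theta:A/N_\varphi\to B$ with $\Theta\circ\pi_\varphi=j$ and $\Delta_B\circ\Theta=(\Theta\otimes\Theta)\circ\Delta_\varphi$. -/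

import Mathlib

open scoped TensorProduct InnerProductSpace ComplexOrder
open UniformSpace

universe u

namespace CQG

/-! ### The Hilbert space tensor product -/

/-- The Hilbert space tensor product of two Hilbert spaces: the completion of the algebraic
tensor product with `⟪h ⊗ k, h' ⊗ k'⟫ = ⟪h, h'⟫ ⟪k, k'⟫`. -/
def HilbertTensor (H K : Type*) [NormedAddCommGroup H] [InnerProductSpace ℂ H]
    [NormedAddCommGroup K] [InnerProductSpace ℂ K] :=
  Completion (H ⊗[ℂ] K)

namespace HilbertTensor

variable {H K : Type*} [NormedAddCommGroup H] [InnerProductSpace ℂ H]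
  [NormedAddCommGroup K] [InnerProductSpace ℂ K]

noncomputable instance : NormedAddCommGroup (HilbertTensor H K) :=
  inferInstanceAs (NormedAddCommGroup (Completion (H ⊗[ℂ] K)))
noncomputable instance : InnerProductSpace ℂ (HilbertTensor H K) :=
  inferInstanceAs (InnerProductSpace ℂ (Completion (H ⊗[ℂ] K)))
instance : CompleteSpace (HilbertTensor H K) :=
  inferInstanceAs (CompleteSpace (Completion (H ⊗[ℂ] K)))

/-- The canonical inclusion of the algebraic tensor product. -/
noncomputable def incl : (H ⊗[ℂ] K) →ₗᵢ[ℂ] HilbertTensor H K :=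
  Completion.toComplₗᵢ (𝕜 := ℂ) (E := H ⊗[ℂ] K)

theorem denseRange_incl : DenseRange (incl : (H ⊗[ℂ] K) → HilbertTensor H K) :=
  Completion.denseRange_coe

theorem ext_clm {F : Type*} [NormedAddCommGroup F] [NormedSpace ℂ F]
    {S T : HilbertTensor H K →L[ℂ] F}
    (h : ∀ v w, S (incl (v ⊗ₜ w)) = T (incl (v ⊗ₜ w))) : S = T := by
  refine DFunLike.coe_injective (denseRange_incl.equalizer S.continuous T.continuous ?_)
  funext x
  induction x using TensorProduct.induction_on with
  | zero => simp
  | tmul v w => exact h v w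
  | add x y hx hy =>
    simp only [Function.comp_apply] at hx hy ⊢
    rw [map_add, map_add, map_add, hx, hy]

/-- The operator `S ⊗ T` on the Hilbert space tensor product. -/
noncomputable def op (S : H →L[ℂ] H) (T : K →L[ℂ] K) :
    HilbertTensor H K →L[ℂ] HilbertTensor H K :=
  ContinuousLinearMap.completion (TensorProduct.mapL S T)

theorem op_incl (S : H →L[ℂ] H) (T : K →L[ℂ] K) (x : H ⊗[ℂ] K) :
    op S T (incl x) = incl (TensorProduct.mapL S T x) :=
  ContinuousLinearMap.completion_apply_coe _ _

theorem op_tmul (S : H →L[ℂ] H) (T : K →L[ℂ] K) (v : H) (w : K) :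
    op S T (incl (v ⊗ₜ w)) = incl (S v ⊗ₜ T w) := by
  rw [op_incl, TensorProduct.mapL_tmul]

theorem op_mul (S S' : H →L[ℂ] H) (T T' : K →L[ℂ] K) :
    op (S * S') (T * T') = op S T * op S' T' :=
  ext_clm fun v w => by simp only [mul_apply_eq_comp, op_tmul]

theorem op_one : op (1 : H →L[ℂ] H) (1 : K →L[ℂ] K) = 1 :=
  ext_clm fun v w => by simp only [one_apply_eq_self, op_tmul]

variable [CompleteSpace H] [CompleteSpace K]

theorem op_star (S : H →L[ℂ] H) (T : K →L[ℂ] K) : op (star S) (star T) = star (op S T) := by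
  rw [ContinuousLinearMap.star_eq_adjoint (op S T)]
  refine (ContinuousLinearMap.eq_adjoint_iff _ _).mpr fun x y => ?_
  refine denseRange_incl.induction_on₂ (p := fun x y : HilbertTensor H K =>
    ⟪op (star S) (star T) x, y⟫_ℂ = ⟪x, op S T y⟫_ℂ) ?_ (fun v w => ?_) x y
  · exact isClosed_eq (by fun_prop) (by fun_prop)
  · rw [op_incl, op_incl, LinearIsometry.inner_map_map, LinearIsometry.inner_map_map]
    induction v using TensorProduct.induction_on with
    | zero => simp
    | add v v' hv hv' => simp only [map_add, inner_add_left, hv, hv']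
    | tmul v v' =>
      induction w using TensorProduct.induction_on with
      | zero => simp
      | add w w' hw hw' => simp only [map_add, inner_add_right, hw, hw']
      | tmul w w' =>
        simp only [TensorProduct.mapL_tmul, TensorProduct.inner_tmul,
          ContinuousLinearMap.star_eq_adjoint, ContinuousLinearMap.adjoint_inner_left]

end HilbertTensor

/-! ### Representations and the spatial tensor product -/

/-- A (unital) representation of a unital C⋆-algebra on a Hilbert space. -/
structure Rep (A : Type u) [CStarAlgebra A] where
  H : Type u
  [normed : NormedAddCommGroup H]
  [inner : InnerProductSpace ℂ H]
  [complete : CompleteSpace H]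
  hom : A →⋆ₐ[ℂ] (H →L[ℂ] H)

attribute [instance] Rep.normed Rep.inner Rep.complete

/-- The algebraic tensor product `A ⊙ B` of two C⋆-algebras. -/
def AlgTensor (A B : Type u) [CStarAlgebra A] [CStarAlgebra B] : Type u := A ⊗[ℂ] B

namespace AlgTensor

variable {A B : Type u} [CStarAlgebra A] [CStarAlgebra B]

noncomputable instance : Ring (AlgTensor A B) := inferInstanceAs (Ring (A ⊗[ℂ] B))
noncomputable instance : Algebra ℂ (AlgTensor A B) := inferInstanceAs (Algebra ℂ (A ⊗[ℂ] B))
noncomputable instance : StarRing (AlgTensor A B) := inferInstanceAs (StarRing (A ⊗[ℂ] B))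
noncomputable instance : StarModule ℂ (AlgTensor A B) :=
  inferInstanceAs (StarModule ℂ (A ⊗[ℂ] B))

/-- The elementary tensor `a ⊗ b` in `A ⊙ B`. -/
noncomputable def tmul (a : A) (b : B) : AlgTensor A B := a ⊗ₜ[ℂ] b

theorem induction {p : AlgTensor A B → Prop} (x : AlgTensor A B)
    (zero : p 0) (tmul : ∀ a b, p (tmul a b)) (add : ∀ x y, p x → p y → p (x + y)) :
    p x :=
  TensorProduct.induction_on (R := ℂ) (M := A) (N := B) (motive := p) x zero tmul add

theorem tmul_mul_tmul (a a' : A) (b b' : B) :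
    tmul a b * tmul a' b' = tmul (a * a') (b * b') :=
  Algebra.TensorProduct.tmul_mul_tmul (R := ℂ) a a' b b'

theorem star_tmul (a : A) (b : B) : star (tmul a b) = tmul (star a) (star b) :=
  TensorProduct.star_tmul (R := ℂ) a b

theorem one_def : (1 : AlgTensor A B) = tmul 1 1 := rfl

theorem add_tmul (a a' : A) (b : B) : tmul (a + a') b = tmul a b + tmul a' b :=
  TensorProduct.add_tmul a a' b
theorem tmul_add (a : A) (b b' : B) : tmul a (b + b') = tmul a b + tmul a b' :=
  TensorProduct.tmul_add a b b'
theorem smul_tmul' (c : ℂ) (a : A) (b : B) : tmul (c • a) b = c • tmul a b := rfl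
theorem tmul_smul (c : ℂ) (a : A) (b : B) : tmul a (c • b) = c • tmul a b :=
  TensorProduct.tmul_smul c a b

/-- A pair of ⋆-homomorphisms with commuting ranges induces a ⋆-homomorphism on `A ⊙ B`,
`a ⊗ b ↦ f a * g b`. -/
noncomputable def lift {C : Type*} [Ring C] [StarRing C] [Algebra ℂ C]
    (f : A →⋆ₐ[ℂ] C) (g : B →⋆ₐ[ℂ] C) (h : ∀ a b, Commute (f a) (g b)) :
    AlgTensor A B →⋆ₐ[ℂ] C :=
  let F : AlgTensor A B →ₐ[ℂ] C :=
    Algebra.TensorProduct.lift (R := ℂ) (S := ℂ) (f : A →ₐ[ℂ] C) (g : B →ₐ[ℂ] C) h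
  have hF : ∀ a b, F (tmul a b) = f a * g b :=
    Algebra.TensorProduct.lift_tmul (R := ℂ) (S := ℂ) (f : A →ₐ[ℂ] C) (g : B →ₐ[ℂ] C) h
  { F with
    map_star' := fun x => by
      change F (star x) = star (F x)
      induction x using AlgTensor.induction with
      | zero => rw [star_zero, map_zero, star_zero]
      | add x y hx hy => rw [star_add, map_add, map_add, star_add, hx, hy]
      | tmul a b => rw [star_tmul, hF, hF, star_mul, map_star, map_star, ← map_star, ← map_star,
          h (star a) (star b)] }

theorem lift_tmul {C : Type*} [Ring C] [StarRing C] [Algebra ℂ C]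
    (f : A →⋆ₐ[ℂ] C) (g : B →⋆ₐ[ℂ] C) (h : ∀ a b, Commute (f a) (g b)) (a : A) (b : B) :
    lift f g h (tmul a b) = f a * g b :=
  Algebra.TensorProduct.lift_tmul (R := ℂ) (S := ℂ) (f : A →ₐ[ℂ] C) (g : B →ₐ[ℂ] C) h a b

theorem hom_ext {F C : Type*} [AddCommMonoid C] [FunLike F (AlgTensor A B) C]
    [AddMonoidHomClass F (AlgTensor A B) C] {f g : F}
    (h : ∀ a b, f (tmul a b) = g (tmul a b)) (x : AlgTensor A B) : f x = g x := by
  induction x using AlgTensor.induction with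
  | zero => rw [map_zero, map_zero]
  | add x y hx hy => rw [map_add, map_add, hx, hy]
  | tmul a b => exact h a b

end AlgTensor

section Spatial

variable {A B : Type u} [CStarAlgebra A] [CStarAlgebra B]

/-- The representation `a ↦ π a ⊗ 1`. -/
noncomputable def repLeft (π : Rep A) (K : Type u) [NormedAddCommGroup K] [InnerProductSpace ℂ K]
    [CompleteSpace K] : A →⋆ₐ[ℂ] (HilbertTensor π.H K →L[ℂ] HilbertTensor π.H K) where
  toFun a := HilbertTensor.op (π.hom a) 1
  map_one' := by rw [map_one, HilbertTensor.op_one]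
  map_zero' := HilbertTensor.ext_clm fun v w => by
    rw [HilbertTensor.op_tmul, map_zero]; simp
  map_add' a a' := HilbertTensor.ext_clm fun v w => by
    simp only [HilbertTensor.op_tmul, map_add, add_apply, TensorProduct.add_tmul]
  map_mul' a a' := by rw [map_mul, ← HilbertTensor.op_mul, one_mul]
  commutes' c := HilbertTensor.ext_clm fun v w => by
    simp only [HilbertTensor.op_tmul, Algebra.algebraMap_eq_smul_one, map_smul, map_one,
      smul_apply, one_apply_eq_self, ← TensorProduct.smul_tmul']
  map_star' a := by rw [map_star, ← HilbertTensor.op_star, star_one]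

/-- The representation `b ↦ 1 ⊗ ρ b`. -/
noncomputable def repRight (H : Type u) [NormedAddCommGroup H] [InnerProductSpace ℂ H]
    [CompleteSpace H] (ρ : Rep B) :
    B →⋆ₐ[ℂ] (HilbertTensor H ρ.H →L[ℂ] HilbertTensor H ρ.H) where
  toFun b := HilbertTensor.op 1 (ρ.hom b)
  map_one' := by rw [map_one, HilbertTensor.op_one]
  map_zero' := HilbertTensor.ext_clm fun v w => by
    rw [HilbertTensor.op_tmul, map_zero]; simp
  map_add' b b' := HilbertTensor.ext_clm fun v w => by
    simp only [HilbertTensor.op_tmul, map_add, add_apply, TensorProduct.tmul_add]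
  map_mul' b b' := by rw [map_mul, ← HilbertTensor.op_mul, one_mul]
  commutes' c := HilbertTensor.ext_clm fun v w => by
    simp only [HilbertTensor.op_tmul, Algebra.algebraMap_eq_smul_one, map_smul, map_one,
      smul_apply, one_apply_eq_self, TensorProduct.tmul_smul]
  map_star' b := by rw [map_star, ← HilbertTensor.op_star, star_one]

/-- The representation `π ⊗ ρ` of `A ⊙ B` on the Hilbert space tensor product, given by
`(π ⊗ ρ)(a ⊗ b) = π a ⊗ ρ b`. -/
noncomputable def tensorRep (π : Rep A) (ρ : Rep B) :
    AlgTensor A B →⋆ₐ[ℂ] (HilbertTensor π.H ρ.H →L[ℂ] HilbertTensor π.H ρ.H) :=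
  AlgTensor.lift (repLeft π ρ.H) (repRight π.H ρ) (fun a b => by
      change HilbertTensor.op (π.hom a) 1 * HilbertTensor.op 1 (ρ.hom b)
        = HilbertTensor.op 1 (ρ.hom b) * HilbertTensor.op (π.hom a) 1
      simp only [← HilbertTensor.op_mul, one_mul, mul_one])

theorem tensorRep_tmul (π : Rep A) (ρ : Rep B) (a : A) (b : B) :
    tensorRep π ρ (AlgTensor.tmul a b) = HilbertTensor.op (π.hom a) (ρ.hom b) := by
  refine (AlgTensor.lift_tmul _ _ _ a b).trans ?_
  change HilbertTensor.op (π.hom a) 1 * HilbertTensor.op 1 (ρ.hom b) = _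
  rw [← HilbertTensor.op_mul, one_mul, mul_one]

theorem exists_norm_tensorRep_le (x : AlgTensor A B) :
    ∃ C : ℝ, ∀ p : Rep A × Rep B, ‖tensorRep p.1 p.2 x‖ ≤ C := by
  induction x using AlgTensor.induction with
  | zero => exact ⟨0, fun p => by rw [map_zero, norm_zero]⟩
  | tmul a b =>
    refine ⟨‖a‖ * ‖b‖, fun p => ?_⟩
    rw [tensorRep, AlgTensor.lift_tmul]
    exact (norm_mul_le _ _).trans (mul_le_mul (NonUnitalStarAlgHom.norm_apply_le _ a)
      (NonUnitalStarAlgHom.norm_apply_le _ b) (norm_nonneg _) (norm_nonneg _))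
  | add x y hx hy =>
    obtain ⟨C, hC⟩ := hx
    obtain ⟨D, hD⟩ := hy
    refine ⟨C + D, fun p => ?_⟩
    rw [map_add]
    exact (norm_add_le _ _).trans (add_le_add (hC p) (hD p))

/-- The spatial C⋆-seminorm on `A ⊙ B`: the supremum of `‖(π ⊗ ρ)(x)‖` over all representations
`π` of `A` and `ρ` of `B`. -/
noncomputable def spatialNorm (x : AlgTensor A B) : ℝ :=
  ⨆ p : Rep A × Rep B, ‖tensorRep p.1 p.2 x‖

theorem norm_tensorRep_le (π : Rep A) (ρ : Rep B) (x : AlgTensor A B) :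
    ‖tensorRep π ρ x‖ ≤ spatialNorm x := by
  obtain ⟨C, hC⟩ := exists_norm_tensorRep_le x
  exact le_ciSup (f := fun p : Rep A × Rep B => ‖tensorRep p.1 p.2 x‖)
    ⟨C, by rintro _ ⟨p, rfl⟩; exact hC p⟩ (π, ρ)

theorem spatialNorm_le {x : AlgTensor A B} {C : ℝ} (hC : 0 ≤ C)
    (h : ∀ (π : Rep A) (ρ : Rep B), ‖tensorRep π ρ x‖ ≤ C) : spatialNorm x ≤ C :=
  Real.iSup_le (fun p => h p.1 p.2) hC

theorem spatialNorm_nonneg (x : AlgTensor A B) : 0 ≤ spatialNorm x :=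
  Real.iSup_nonneg fun _ => norm_nonneg _

theorem spatialNorm_zero : spatialNorm (0 : AlgTensor A B) = 0 :=
  le_antisymm (spatialNorm_le le_rfl fun π ρ => by rw [map_zero, norm_zero])
    (spatialNorm_nonneg _)

theorem spatialNorm_add_le (x y : AlgTensor A B) :
    spatialNorm (x + y) ≤ spatialNorm x + spatialNorm y :=
  spatialNorm_le (add_nonneg (spatialNorm_nonneg x) (spatialNorm_nonneg y)) fun π ρ => by
    rw [map_add]
    exact (norm_add_le _ _).trans
      (add_le_add (norm_tensorRep_le π ρ x) (norm_tensorRep_le π ρ y))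

theorem spatialNorm_neg (x : AlgTensor A B) : spatialNorm (-x) = spatialNorm x := by
  unfold spatialNorm
  exact iSup_congr fun p => by rw [map_neg, norm_neg]

theorem spatialNorm_star (x : AlgTensor A B) : spatialNorm (star x) = spatialNorm x := by
  unfold spatialNorm
  exact iSup_congr fun p => by rw [map_star, norm_star]

theorem spatialNorm_mul_le (x y : AlgTensor A B) :
    spatialNorm (x * y) ≤ spatialNorm x * spatialNorm y :=
  spatialNorm_le (mul_nonneg (spatialNorm_nonneg x) (spatialNorm_nonneg y)) fun π ρ => by
    rw [map_mul]
    exact (norm_mul_le _ _).trans (mul_le_mul (norm_tensorRep_le π ρ x)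
      (norm_tensorRep_le π ρ y) (norm_nonneg _) (spatialNorm_nonneg x))

theorem spatialNorm_smul_le (c : ℂ) (x : AlgTensor A B) :
    spatialNorm (c • x) ≤ ‖c‖ * spatialNorm x :=
  spatialNorm_le (mul_nonneg (norm_nonneg c) (spatialNorm_nonneg x)) fun π ρ => by
    rw [map_smul, norm_smul]
    exact mul_le_mul_of_nonneg_left (norm_tensorRep_le π ρ x) (norm_nonneg c)

theorem spatialNorm_mul_self_le (x : AlgTensor A B) :
    spatialNorm x * spatialNorm x ≤ spatialNorm (star x * x) := by
  have key : spatialNorm x ≤ √(spatialNorm (star x * x)) :=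
    spatialNorm_le (Real.sqrt_nonneg _) fun π ρ => Real.le_sqrt_of_sq_le <| by
      rw [sq, ← CStarRing.norm_star_mul_self, ← map_star, ← map_mul]
      exact norm_tensorRep_le π ρ _
  calc _ ≤ √(spatialNorm (star x * x)) * √(spatialNorm (star x * x)) :=
        mul_le_mul key key (spatialNorm_nonneg _) (Real.sqrt_nonneg _)
    _ = _ := Real.mul_self_sqrt (spatialNorm_nonneg _)

noncomputable instance : SeminormedRing (AlgTensor A B) where
  __ := (inferInstance : Ring (AlgTensor A B))
  __ := AddGroupSeminorm.toSeminormedAddCommGroup (E := AlgTensor A B)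
    { toFun := spatialNorm
      map_zero' := spatialNorm_zero
      add_le' := spatialNorm_add_le
      neg' := spatialNorm_neg }
  norm_mul_le := spatialNorm_mul_le

theorem AlgTensor.norm_def (x : AlgTensor A B) : ‖x‖ = spatialNorm x := rfl

noncomputable instance : NormedAlgebra ℂ (AlgTensor A B) where
  norm_smul_le := spatialNorm_smul_le

instance : NormedStarGroup (AlgTensor A B) where
  norm_star_le x := (spatialNorm_star x).le

end Spatial

/-- The spatial tensor product `A ⊗ B` of two unital C⋆-algebras: the completion of the algebraic
tensor product in the spatial C⋆-norm. -/
def SpatialTensor (A B : Type u) [CStarAlgebra A] [CStarAlgebra B] : Type u :=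
  Completion (AlgTensor A B)

namespace SpatialTensor

variable {A B C D : Type u} [CStarAlgebra A] [CStarAlgebra B] [CStarAlgebra C] [CStarAlgebra D]

noncomputable instance : NormedRing (SpatialTensor A B) :=
  inferInstanceAs (NormedRing (Completion (AlgTensor A B)))
instance : CompleteSpace (SpatialTensor A B) :=
  inferInstanceAs (CompleteSpace (Completion (AlgTensor A B)))

/-- The canonical map `A ⊙ B → A ⊗ B`. -/
noncomputable def ofAlg : AlgTensor A B →+* SpatialTensor A B :=
  Completion.coeRingHom (α := AlgTensor A B)

theorem norm_ofAlg (x : AlgTensor A B) : ‖ofAlg x‖ = ‖x‖ :=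
  Completion.norm_coe x

theorem denseRange_ofAlg : DenseRange (ofAlg : AlgTensor A B → SpatialTensor A B) :=
  Completion.denseRange_coe

theorem continuous_ofAlg : Continuous (ofAlg : AlgTensor A B → SpatialTensor A B) :=
  Completion.continuous_coe _

noncomputable instance : NormedSpace ℂ (SpatialTensor A B) :=
  inferInstanceAs (NormedSpace ℂ (Completion (AlgTensor A B)))

theorem ofAlg_smul (c : ℂ) (x : AlgTensor A B) : ofAlg (c • x) = c • ofAlg x :=
  Completion.coe_smul c x

theorem induction_ofAlg {p : SpatialTensor A B → Prop} (hp : IsClosed {x | p x})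
    (h : ∀ x, p (ofAlg x)) (x : SpatialTensor A B) : p x :=
  denseRange_ofAlg.induction_on x hp h

theorem induction_ofAlg₂ {p : SpatialTensor A B → SpatialTensor A B → Prop}
    (hp : IsClosed {x : SpatialTensor A B × SpatialTensor A B | p x.1 x.2})
    (h : ∀ x y, p (ofAlg x) (ofAlg y)) (x y : SpatialTensor A B) : p x y :=
  denseRange_ofAlg.induction_on₂ hp h x y

theorem algebraMap_commutes (r : ℂ) (x : SpatialTensor A B) :
    ofAlg (algebraMap ℂ (AlgTensor A B) r) * x = x * ofAlg (algebraMap ℂ (AlgTensor A B) r) := by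
  refine induction_ofAlg (isClosed_eq (continuous_const.mul continuous_id)
    (continuous_id.mul continuous_const)) (fun y => ?_) x
  change ofAlg (algebraMap ℂ (AlgTensor A B) r) * ofAlg y
    = ofAlg y * ofAlg (algebraMap ℂ (AlgTensor A B) r)
  rw [← map_mul, ← map_mul, Algebra.commutes]

theorem smul_eq_mul_ofAlg (r : ℂ) (x : SpatialTensor A B) :
    r • x = ofAlg (algebraMap ℂ (AlgTensor A B) r) * x := by
  refine induction_ofAlg (isClosed_eq (continuous_id.const_smul r)
    (continuous_const.mul continuous_id)) (fun y => ?_) x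
  change r • ofAlg y = ofAlg (algebraMap ℂ (AlgTensor A B) r) * ofAlg y
  rw [← map_mul, ← ofAlg_smul, Algebra.smul_def]

noncomputable instance : NormedAlgebra ℂ (SpatialTensor A B) where
  algebraMap := (ofAlg (A := A) (B := B)).comp (algebraMap ℂ (AlgTensor A B))
  commutes' := algebraMap_commutes
  smul_def' := smul_eq_mul_ofAlg
  norm_smul_le := norm_smul_le

noncomputable instance : Star (SpatialTensor A B) where
  star := Completion.map (star : AlgTensor A B → AlgTensor A B)

theorem uniformContinuous_star_alg :
    UniformContinuous (star : AlgTensor A B → AlgTensor A B) :=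
  (starNormedAddGroupHom (E := AlgTensor A B)).uniformContinuous

theorem star_ofAlg (x : AlgTensor A B) : star (ofAlg x) = ofAlg (star x) :=
  Completion.map_coe (uniformContinuous_star_alg) x

theorem continuous_star' : Continuous (star : SpatialTensor A B → SpatialTensor A B) :=
  Completion.continuous_map

noncomputable instance : StarRing (SpatialTensor A B) where
  star_involutive := induction_ofAlg
    (isClosed_eq (continuous_star'.comp continuous_star') continuous_id)
    fun y => by rw [star_ofAlg, star_ofAlg, star_star]
  star_mul := induction_ofAlg₂
    (isClosed_eq (continuous_star'.comp (continuous_fst.mul continuous_snd))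
      ((continuous_star'.comp continuous_snd).mul (continuous_star'.comp continuous_fst)))
    fun v w => by rw [← map_mul, star_ofAlg, star_ofAlg, star_ofAlg, star_mul, map_mul]
  star_add := induction_ofAlg₂
    (isClosed_eq (continuous_star'.comp (continuous_fst.add continuous_snd))
      ((continuous_star'.comp continuous_fst).add (continuous_star'.comp continuous_snd)))
    fun v w => by rw [← map_add, star_ofAlg, star_ofAlg, star_ofAlg, star_add, map_add]

theorem norm_mul_self_le' (x : SpatialTensor A B) : ‖x‖ * ‖x‖ ≤ ‖star x * x‖ := by
  refine induction_ofAlg (isClosed_le (continuous_norm.mul continuous_norm)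
      ((continuous_star'.mul continuous_id).norm)) (fun y => ?_) x
  change ‖ofAlg y‖ * ‖ofAlg y‖ ≤ ‖star (ofAlg y) * ofAlg y‖
  rw [star_ofAlg, ← map_mul, norm_ofAlg, norm_ofAlg]
  exact spatialNorm_mul_self_le y

theorem star_smul' (c : ℂ) (x : SpatialTensor A B) : star (c • x) = star c • star x := by
  refine induction_ofAlg (isClosed_eq (continuous_star'.comp (continuous_id.const_smul c))
      (continuous_star'.const_smul (star c))) (fun y => ?_) x
  change star (c • ofAlg y) = star c • star (ofAlg y)
  rw [← ofAlg_smul, star_ofAlg, star_ofAlg, star_smul, ofAlg_smul]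

/-- The spatial tensor product is a C⋆-algebra. -/
noncomputable instance : CStarAlgebra (SpatialTensor A B) where
  norm_mul_self_le := norm_mul_self_le'
  star_smul := star_smul'

/-- The elementary tensor `a ⊗ b` in the spatial tensor product. -/
noncomputable def tmul (a : A) (b : B) : SpatialTensor A B := ofAlg (AlgTensor.tmul a b)

/-- A contractive ⋆-homomorphism on `A ⊙ B` extends to the spatial tensor product. -/
noncomputable def extend (F : AlgTensor A B →⋆ₐ[ℂ] C) (hF : ∀ x, ‖F x‖ ≤ ‖x‖) :
    SpatialTensor A B →⋆ₐ[ℂ] C :=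
  have hc : Continuous F := AddMonoidHomClass.continuous_of_bound F 1 (by simpa using hF)
  let G : SpatialTensor A B →+* C :=
    Completion.extensionHom ((F : AlgTensor A B →ₐ[ℂ] C) : AlgTensor A B →+* C) hc
  have hG : ∀ x, G (ofAlg x) = F x :=
    Completion.extensionHom_coe ((F : AlgTensor A B →ₐ[ℂ] C) : AlgTensor A B →+* C) hc
  have hGc : Continuous G := Completion.continuous_extension
  { G with
    commutes' := fun c => by
      change G (ofAlg (algebraMap ℂ (AlgTensor A B) c)) = _
      rw [hG, AlgHomClass.commutes]
    map_star' := induction_ofAlg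
      (isClosed_eq (hGc.comp continuous_star') (continuous_star.comp hGc))
      fun y => by
        change G (star (ofAlg y)) = star (G (ofAlg y))
        rw [star_ofAlg, hG, hG, map_star] }

theorem extend_ofAlg (F : AlgTensor A B →⋆ₐ[ℂ] C) (hF : ∀ x, ‖F x‖ ≤ ‖x‖) (x : AlgTensor A B) :
    extend F hF (ofAlg x) = F x :=
  Completion.extensionHom_coe ((F : AlgTensor A B →ₐ[ℂ] C) : AlgTensor A B →+* C)
    (AddMonoidHomClass.continuous_of_bound F 1 (by simpa using hF)) x

theorem continuous_hom (f : A →⋆ₐ[ℂ] C) : Continuous f :=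
  AddMonoidHomClass.continuous_of_bound f 1 fun x => by
    rw [one_mul]; exact NonUnitalStarAlgHom.norm_apply_le f x

theorem hom_ext {f g : SpatialTensor A B →⋆ₐ[ℂ] C} (h : ∀ a b, f (tmul a b) = g (tmul a b)) :
    f = g := by
  refine DFunLike.coe_injective (denseRange_ofAlg.equalizer
    (continuous_hom f) (continuous_hom g) ?_)
  funext x
  induction x using AlgTensor.induction with
  | zero => simp
  | tmul v w => exact h v w
  | add x y hx hy =>
    simp only [Function.comp_apply] at hx hy ⊢
    rw [map_add, map_add, map_add, hx, hy]

/-- The embedding `a ↦ a ⊗ 1`. -/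
noncomputable def inl : A →⋆ₐ[ℂ] SpatialTensor A B where
  toFun a := tmul a 1
  map_one' := map_one ofAlg
  map_mul' a a' := by simp only [tmul, ← map_mul, AlgTensor.tmul_mul_tmul, mul_one]
  map_zero' := by rw [tmul, ← zero_smul ℂ (0 : A), AlgTensor.smul_tmul', ofAlg_smul, zero_smul]
  map_add' a a' := by simp only [tmul, AlgTensor.add_tmul, map_add]
  commutes' c := by
    rw [Algebra.algebraMap_eq_smul_one, Algebra.algebraMap_eq_smul_one, tmul,
      AlgTensor.smul_tmul', ofAlg_smul, ← AlgTensor.one_def, map_one]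
  map_star' a := by rw [tmul, tmul, star_ofAlg, AlgTensor.star_tmul, star_one]

/-- The embedding `b ↦ 1 ⊗ b`. -/
noncomputable def inr : B →⋆ₐ[ℂ] SpatialTensor A B where
  toFun b := tmul 1 b
  map_one' := map_one ofAlg
  map_mul' b b' := by simp only [tmul, ← map_mul, AlgTensor.tmul_mul_tmul, mul_one]
  map_zero' := by rw [tmul, ← zero_smul ℂ (0 : B), AlgTensor.tmul_smul, ofAlg_smul, zero_smul]
  map_add' b b' := by simp only [tmul, AlgTensor.tmul_add, map_add]
  commutes' c := by
    rw [Algebra.algebraMap_eq_smul_one, Algebra.algebraMap_eq_smul_one, tmul,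
      AlgTensor.tmul_smul, ofAlg_smul, ← AlgTensor.one_def, map_one]
  map_star' b := by rw [tmul, tmul, star_ofAlg, AlgTensor.star_tmul, star_one]

theorem inl_mul_inr (a : A) (b : B) : (inl a * inr b : SpatialTensor A B) = tmul a b := by
  change tmul a 1 * tmul 1 b = _
  simp only [tmul, ← map_mul, AlgTensor.tmul_mul_tmul, mul_one, one_mul]

theorem inr_mul_inl (a : A) (b : B) : (inr b * inl a : SpatialTensor A B) = tmul a b := by
  change tmul 1 b * tmul a 1 = _
  simp only [tmul, ← map_mul, AlgTensor.tmul_mul_tmul, mul_one, one_mul]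

theorem commute_comp (f : A →⋆ₐ[ℂ] C) (g : B →⋆ₐ[ℂ] D) (a : A) (b : B) :
    Commute ((inl.comp f : A →⋆ₐ[ℂ] SpatialTensor C D) a) (inr.comp g b) :=
  (inl_mul_inr (f a) (g b)).trans (inr_mul_inl (f a) (g b)).symm

/-- The ⋆-homomorphism `f ⊙ g : A ⊙ B → C ⊗ D`. -/
noncomputable def mapAlg (f : A →⋆ₐ[ℂ] C) (g : B →⋆ₐ[ℂ] D) :
    AlgTensor A B →⋆ₐ[ℂ] SpatialTensor C D :=
  AlgTensor.lift (inl.comp f) (inr.comp g) (commute_comp f g)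

theorem mapAlg_tmul (f : A →⋆ₐ[ℂ] C) (g : B →⋆ₐ[ℂ] D) (a : A) (b : B) :
    mapAlg f g (AlgTensor.tmul a b) = tmul (f a) (g b) :=
  (AlgTensor.lift_tmul _ _ _ a b).trans (inl_mul_inr (f a) (g b))

/-- The pullback of a representation along a ⋆-homomorphism. -/
noncomputable abbrev _root_.CQG.Rep.comap (π : Rep C) (f : A →⋆ₐ[ℂ] C) : Rep A where
  H := π.H
  hom := π.hom.comp f

/-- The representation `π ⊗ ρ` of the spatial tensor product. -/
noncomputable abbrev rep (π : Rep A) (ρ : Rep B) : Rep (SpatialTensor A B) where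
  H := HilbertTensor π.H ρ.H
  hom := extend (tensorRep π ρ) (norm_tensorRep_le π ρ)

theorem rep_ofAlg (π : Rep A) (ρ : Rep B) (x : AlgTensor A B) :
    (rep π ρ).hom (ofAlg x) = tensorRep π ρ x :=
  extend_ofAlg (tensorRep π ρ) (norm_tensorRep_le π ρ) x

theorem norm_le_of_forall_rep (x : SpatialTensor A B) {M : ℝ} (hM : 0 ≤ M)
    (h : ∀ (π : Rep A) (ρ : Rep B), ‖(rep π ρ).hom x‖ ≤ M) : ‖x‖ ≤ M := by
  refine le_of_forall_pos_le_add fun ε hε => ?_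
  obtain ⟨y, hy⟩ := Metric.denseRange_iff.mp denseRange_ofAlg x (ε / 2) (half_pos hε)
  rw [dist_eq_norm] at hy
  have h1 : ‖ofAlg y‖ ≤ M + ε / 2 := by
    rw [norm_ofAlg]
    refine spatialNorm_le (by positivity) fun π ρ => ?_
    rw [← rep_ofAlg]
    have h2 : (rep π ρ).hom (ofAlg y) = (rep π ρ).hom x - (rep π ρ).hom (x - ofAlg y) := by
      rw [map_sub, sub_sub_cancel]
    rw [h2]
    refine (norm_sub_le _ _).trans (add_le_add (h π ρ) ?_)
    exact (NonUnitalStarAlgHom.norm_apply_le _ _).trans hy.le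
  calc ‖x‖ = ‖(x - ofAlg y) + ofAlg y‖ := by rw [sub_add_cancel]
    _ ≤ ε / 2 + (M + ε / 2) := (norm_add_le _ _).trans (add_le_add hy.le h1)
    _ = M + ε := by ring

theorem norm_mapAlg_le (f : A →⋆ₐ[ℂ] C) (g : B →⋆ₐ[ℂ] D) (x : AlgTensor A B) :
    ‖mapAlg f g x‖ ≤ ‖x‖ := by
  refine norm_le_of_forall_rep _ (norm_nonneg x) fun π ρ => ?_
  have h : (rep π ρ).hom (mapAlg f g x) = tensorRep (π.comap f) (ρ.comap g) x := by
    induction x using AlgTensor.induction with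
    | zero => rw [map_zero, map_zero, map_zero]
    | add x y hx hy => rw [map_add, map_add, map_add, hx, hy]
    | tmul a b => rw [mapAlg_tmul, tmul, rep_ofAlg, tensorRep_tmul, tensorRep_tmul]; rfl
  rw [h]
  exact norm_tensorRep_le _ _ x

/-- The tensor product `f ⊗ g : A ⊗ B → C ⊗ D` of ⋆-homomorphisms. -/
noncomputable def map (f : A →⋆ₐ[ℂ] C) (g : B →⋆ₐ[ℂ] D) :
    SpatialTensor A B →⋆ₐ[ℂ] SpatialTensor C D :=
  extend (mapAlg f g) (norm_mapAlg_le f g)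

theorem map_tmul (f : A →⋆ₐ[ℂ] C) (g : B →⋆ₐ[ℂ] D) (a : A) (b : B) :
    map f g (tmul a b) = tmul (f a) (g b) := by
  rw [tmul, map, extend_ofAlg, mapAlg_tmul]

end SpatialTensor

/-! ### States -/

/-- A state on a unital C⋆-algebra: a positive linear functional with `φ 1 = 1`. -/
structure State (A : Type u) [CStarAlgebra A] where
  toCLM : A →L[ℂ] ℂ
  nonneg' : ∀ a, 0 ≤ toCLM (star a * a)
  map_one' : toCLM 1 = 1

noncomputable instance (A : Type u) [CStarAlgebra A] : CoeFun (State A) (fun _ => A → ℂ) := ⟨fun φ => φ.toCLM⟩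

section States

variable {A B : Type u} [CStarAlgebra A] [CStarAlgebra B]

/-- A state is a vector functional in some representation (GNS). -/
theorem State.exists_rep (φ : State A) :
    ∃ (π : Rep A) (ξ : π.H), ‖ξ‖ = 1 ∧ ∀ a, ⟪ξ, π.hom a ξ⟫_ℂ = φ a := by
  let _ : PartialOrder A := CStarAlgebra.spectralOrder A
  have _ : StarOrderedRing A := CStarAlgebra.spectralOrderedRing A
  let f : A →ₚ[ℂ] ℂ := PositiveLinearMap.mk₀ (φ.toCLM : A →ₗ[ℂ] ℂ) fun x hx => by
    obtain ⟨b, rfl⟩ := CStarAlgebra.nonneg_iff_eq_star_mul_self.mp hx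
    exact φ.nonneg' b
  have hf : ∀ a, f a = φ a := fun _ => rfl
  let ξ : f.GNS := ((f.toPreGNS 1 : f.PreGNS) : Completion f.PreGNS)
  have key : ∀ a, ⟪ξ, f.gnsStarAlgHom a ξ⟫_ℂ = φ a := fun a => by
    change ⟪ξ, f.gnsNonUnitalStarAlgHom a ξ⟫_ℂ = φ a
    rw [f.gnsNonUnitalStarAlgHom_apply_coe, Completion.inner_coe, f.preGNS_inner_def]
    simp [hf]
  refine ⟨⟨f.GNS, f.gnsStarAlgHom⟩, ξ, ?_, key⟩
  have h1 := key 1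
  rw [map_one, one_apply_eq_self, inner_self_eq_norm_sq_to_K] at h1
  have h2 : (φ : A → ℂ) 1 = 1 := φ.map_one'
  rw [h2, RCLike.ofReal_eq_complex_ofReal] at h1
  have h3 : ‖ξ‖ ^ 2 = 1 := by exact_mod_cast h1
  have h4 := norm_nonneg ξ
  nlinarith

/-- A unital contractive functional on a C⋆-algebra is a state. -/
theorem nonneg_of_norm_le_one (f : A →L[ℂ] ℂ) (h1 : f 1 = 1) (hf : ‖f‖ ≤ 1) (a : A) :
    0 ≤ f (star a * a) := by
  let _ : PartialOrder A := CStarAlgebra.spectralOrder A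
  have _ : StarOrderedRing A := CStarAlgebra.spectralOrderedRing A
  have hle : ∀ x, ‖f x‖ ≤ ‖x‖ := fun x =>
    (f.le_opNorm x).trans (by simpa using mul_le_mul_of_nonneg_right hf (norm_nonneg x))
  set p : A := star a * a with hp
  have hp0 : 0 ≤ p := star_mul_self_nonneg a
  have hps : IsSelfAdjoint p := IsSelfAdjoint.star_mul_self a
  set r : ℝ := ‖p‖ with hr
  have hr0 : 0 ≤ r := norm_nonneg p
  rw [Complex.le_def]
  simp only [Complex.zero_re, Complex.zero_im]
  constructor
  · have h2 : ‖algebraMap ℝ A r - p‖ ≤ r := by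
      have hb : algebraMap ℝ A r - p ≤ algebraMap ℝ A r := sub_le_self _ hp0
      have h0 : 0 ≤ algebraMap ℝ A r - p := sub_nonneg.mpr hps.le_algebraMap_norm_self
      exact (CStarAlgebra.norm_le_iff_le_algebraMap _ hr0 h0).mpr hb
    have h3 := (hle _).trans h2
    rw [map_sub, IsScalarTower.algebraMap_apply ℝ ℂ A, Algebra.algebraMap_eq_smul_one, map_smul,
      h1] at h3
    have h4 := (Complex.re_le_norm _).trans h3
    simp at h4
    exact h4
  · have key : ∀ t : ℝ, ((f p).im + t) ^ 2 ≤ r ^ 2 + t ^ 2 := fun t => by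
      have h2 : ‖p + (Complex.I * t) • (1 : A)‖ ^ 2 ≤ r ^ 2 + t ^ 2 := by
        rw [sq, ← CStarRing.norm_star_mul_self]
        have h5 : star (p + (Complex.I * t) • (1 : A)) * (p + (Complex.I * t) • (1 : A))
            = p * p + ((t ^ 2 : ℝ) : ℂ) • (1 : A) := by
          rw [star_add, star_smul, star_one, hps.star_eq]
          simp only [add_mul, mul_add, smul_mul_assoc, mul_smul_comm, one_mul, mul_one]
          have h6 : star (Complex.I * (t : ℂ)) = -(Complex.I * t) := by simp
          rw [h6]
          have h7 : -(Complex.I * (t : ℂ)) * (Complex.I * t) = ((t ^ 2 : ℝ) : ℂ) := by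
            push_cast
            linear_combination (-(t : ℂ) ^ 2) * Complex.I_sq
          rw [smul_add, smul_smul, mul_comm (Complex.I * (t : ℂ)) (-(Complex.I * t)), h7, neg_smul]
          abel
        rw [h5]
        refine (norm_add_le _ _).trans (add_le_add ?_ ?_)
        · rw [sq]; exact norm_mul_le _ _
        · rw [norm_smul, Complex.norm_real, Real.norm_of_nonneg (sq_nonneg t)]
          have : Nontrivial A := ⟨1, 0, fun h0 => by simp [h0] at h1⟩
          rw [CStarRing.norm_one, mul_one]
      have h3 := hle (p + (Complex.I * t) • (1 : A))
      rw [map_add, map_smul, h1] at h3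
      have h4 := (Complex.abs_im_le_norm _).trans h3
      simp at h4
      calc ((f p).im + t) ^ 2 = |(f p).im + t| ^ 2 := (sq_abs _).symm
        _ ≤ ‖p + (Complex.I * t) • (1 : A)‖ ^ 2 := by gcongr
        _ ≤ _ := h2
    have k1 := key ((r ^ 2 + 1) / (2 * (f p).im))
    by_contra h
    have h' : (f p).im ≠ 0 := fun h0 => h h0.symm
    have : (f p).im * ((r ^ 2 + 1) / (2 * (f p).im)) = (r ^ 2 + 1) / 2 := by
      field_simp
    nlinarith [sq_nonneg (f p).im]

/-- Representations compute the norm from above (Gelfand–Naimark). -/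
theorem norm_le_of_forall_rep (b : B) {M : ℝ} (hM : 0 ≤ M)
    (h : ∀ (ρ : Rep B) (v : ρ.H), ‖ρ.hom b v‖ ≤ M * ‖v‖) : ‖b‖ ≤ M := by
  rcases subsingleton_or_nontrivial B with hB | hB
  · rw [Subsingleton.elim b 0, norm_zero]; exact hM
  let _ : PartialOrder B := CStarAlgebra.spectralOrder B
  have _ : StarOrderedRing B := CStarAlgebra.spectralOrderedRing B
  set c : B := star b * b with hc
  have hcs : IsSelfAdjoint c := IsSelfAdjoint.star_mul_self b
  have _ : IsStarNormal c := hcs.isStarNormal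
  let S := StarAlgebra.elemental ℂ c
  let c' : S := ⟨c, StarAlgebra.elemental.self_mem ℂ c⟩
  have hspec : ((‖c‖ : ℝ) : ℂ) ∈ spectrum ℂ c' := by
    have h1 : ‖c‖ ∈ spectrum ℝ c := CStarAlgebra.norm_mem_spectrum_of_nonneg (star_mul_self_nonneg b)
    have h2 : ((‖c‖ : ℝ) : ℂ) ∈ spectrum ℂ c := by
      have := (spectrum.algebraMap_mem_iff ℂ (R := ℝ) (a := c) (r := ‖c‖)).mpr h1
      simpa using this
    have _ : IsClosed (S : Set B) := StarAlgebra.elemental.isClosed ℂ c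
    rwa [StarSubalgebra.spectrum_eq (S := S) (a := c')]
  obtain ⟨χ, hχ⟩ := (WeakDual.CharacterSpace.mem_spectrum_iff_exists).mp hspec
  let χ' : StrongDual ℂ S := WeakDual.toStrongDual (χ : WeakDual ℂ S)
  have hχ' : ∀ x : S, χ' x = χ x := fun _ => rfl
  have hχn : ‖χ'‖ ≤ 1 := ContinuousLinearMap.opNorm_le_bound _ zero_le_one fun x => by
    rw [hχ', one_mul]
    exact AlgHom.norm_apply_le_self χ x
  obtain ⟨g, hg, hgn⟩ := exists_extension_norm_eq (S.toSubalgebra.toSubmodule) χ'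
  have hg1 : g 1 = 1 := (hg (1 : S)).trans ((hχ' 1).trans (map_one χ))
  have hgc : g c = (‖c‖ : ℂ) := (hg c').trans ((hχ' c').trans hχ)
  let ψ : State B := ⟨g, nonneg_of_norm_le_one g hg1 (hgn.le.trans hχn), hg1⟩
  obtain ⟨ρ, ξ, hξ, hρ⟩ := ψ.exists_rep
  have h1 := h ρ ξ
  rw [hξ, mul_one] at h1
  have h2 : (‖ρ.hom b ξ‖ : ℂ) ^ 2 = (‖c‖ : ℂ) := by
    rw [← hgc]
    have h3 := hρ c
    rw [hc, map_mul, map_star, mul_apply_eq_comp, ContinuousLinearMap.star_eq_adjoint,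
      ContinuousLinearMap.adjoint_inner_right, inner_self_eq_norm_sq_to_K] at h3
    exact h3
  have h4 : ‖ρ.hom b ξ‖ ^ 2 = ‖b‖ ^ 2 := by
    have h5 : ‖ρ.hom b ξ‖ ^ 2 = ‖c‖ := by exact_mod_cast h2
    rw [h5, hc, CStarRing.norm_star_mul_self, sq]
  have h6 : ‖b‖ = ‖ρ.hom b ξ‖ := by
    have := congrArg Real.sqrt h4
    rw [Real.sqrt_sq (norm_nonneg _), Real.sqrt_sq (norm_nonneg _)] at this
    exact this.symm
  rw [h6]; exact h1

/-! ### Slice maps -/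

/-- The algebraic slice map `ω ⊙ id : A ⊙ B → B`, `a ⊗ b ↦ ω a • b`. -/
noncomputable def sliceLeftAlg (ω : A →ₗ[ℂ] ℂ) : AlgTensor A B →ₗ[ℂ] B :=
  (TensorProduct.lift ((LinearMap.lsmul ℂ B : ℂ →ₗ[ℂ] B →ₗ[ℂ] B).comp ω) : A ⊗[ℂ] B →ₗ[ℂ] B)

theorem sliceLeftAlg_tmul (ω : A →ₗ[ℂ] ℂ) (a : A) (b : B) :
    sliceLeftAlg ω (AlgTensor.tmul a b) = ω a • b :=
  TensorProduct.lift.tmul a b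

/-- The algebraic slice map `id ⊙ ω : A ⊙ B → A`, `a ⊗ b ↦ ω b • a`. -/
noncomputable def sliceRightAlg (ω : B →ₗ[ℂ] ℂ) : AlgTensor A B →ₗ[ℂ] A :=
  (TensorProduct.lift ((LinearMap.lsmul ℂ A : ℂ →ₗ[ℂ] A →ₗ[ℂ] A).comp ω).flip :
    A ⊗[ℂ] B →ₗ[ℂ] A)

theorem sliceRightAlg_tmul (ω : B →ₗ[ℂ] ℂ) (a : A) (b : B) :
    sliceRightAlg ω (AlgTensor.tmul a b) = ω b • a :=
  TensorProduct.lift.tmul a b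

/-- The vector functional `a ↦ ⟪v, π a w⟫`. -/
noncomputable def Rep.vec (π : Rep A) (v w : π.H) : A →ₗ[ℂ] ℂ where
  toFun a := ⟪v, π.hom a w⟫_ℂ
  map_add' a b := by rw [map_add, add_apply, inner_add_right]
  map_smul' c a := by rw [map_smul, smul_apply, inner_smul_right]; rfl

theorem inner_tensorRep_left (π : Rep A) (ρ : Rep B) (x : AlgTensor A B) (v v' : π.H)
    (w w' : ρ.H) :
    ⟪HilbertTensor.incl (v ⊗ₜ w), tensorRep π ρ x (HilbertTensor.incl (v' ⊗ₜ w'))⟫_ℂ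
      = ⟪w, ρ.hom (sliceLeftAlg (π.vec v v') x) w'⟫_ℂ := by
  induction x using AlgTensor.induction with
  | zero => simp only [map_zero, zero_apply, inner_zero_right]
  | add x y hx hy => simp only [map_add, add_apply, inner_add_right, hx, hy]
  | tmul a b =>
    rw [tensorRep_tmul, HilbertTensor.op_tmul, LinearIsometry.inner_map_map,
      TensorProduct.inner_tmul, sliceLeftAlg_tmul, map_smul, smul_apply, inner_smul_right]
    rfl

theorem inner_tensorRep_right (π : Rep A) (ρ : Rep B) (x : AlgTensor A B) (v v' : π.H)
    (w w' : ρ.H) :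
    ⟪HilbertTensor.incl (v ⊗ₜ w), tensorRep π ρ x (HilbertTensor.incl (v' ⊗ₜ w'))⟫_ℂ
      = ⟪v, π.hom (sliceRightAlg (ρ.vec w w') x) v'⟫_ℂ := by
  induction x using AlgTensor.induction with
  | zero => simp only [map_zero, zero_apply, inner_zero_right]
  | add x y hx hy => simp only [map_add, add_apply, inner_add_right, hx, hy]
  | tmul a b =>
    rw [tensorRep_tmul, HilbertTensor.op_tmul, LinearIsometry.inner_map_map,
      TensorProduct.inner_tmul, sliceRightAlg_tmul, map_smul, smul_apply, inner_smul_right,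
      mul_comm]
    rfl

theorem norm_le_of_inner {H : Type*} [NormedAddCommGroup H] [InnerProductSpace ℂ H] {u : H}
    {M : ℝ} (hM : 0 ≤ M) (h : ‖⟪u, u⟫_ℂ‖ ≤ M * ‖u‖) : ‖u‖ ≤ M := by
  rw [inner_self_eq_norm_sq_to_K, norm_pow, RCLike.norm_ofReal, abs_norm, sq] at h
  by_contra hlt
  push Not at hlt
  exact absurd (le_of_mul_le_mul_right h (hM.trans_lt hlt)) (not_le.mpr hlt)

theorem norm_sliceLeftAlg_le (φ : State A) (x : AlgTensor A B) :
    ‖sliceLeftAlg (φ.toCLM : A →ₗ[ℂ] ℂ) x‖ ≤ ‖x‖ := by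
  obtain ⟨π, ξ, hξ, hπ⟩ := φ.exists_rep
  have hvec : (φ.toCLM : A →ₗ[ℂ] ℂ) = π.vec ξ ξ := LinearMap.ext fun a => (hπ a).symm
  refine norm_le_of_forall_rep _ (norm_nonneg x) fun ρ w => ?_
  refine norm_le_of_inner (by positivity) ?_
  nth_rewrite 2 [hvec]
  rw [← inner_tensorRep_left]
  refine (norm_inner_le_norm _ _).trans ?_
  have h1 := (tensorRep π ρ x).le_of_opNorm_le (norm_tensorRep_le π ρ x)
    (HilbertTensor.incl (ξ ⊗ₜ w))
  simp only [LinearIsometry.norm_map, TensorProduct.norm_tmul, hξ, one_mul] at h1 ⊢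
  rw [mul_comm]
  exact mul_le_mul_of_nonneg_right h1 (norm_nonneg _)

theorem norm_sliceRightAlg_le (ψ : State B) (x : AlgTensor A B) :
    ‖sliceRightAlg (ψ.toCLM : B →ₗ[ℂ] ℂ) x‖ ≤ ‖x‖ := by
  obtain ⟨ρ, ξ, hξ, hρ⟩ := ψ.exists_rep
  have hvec : (ψ.toCLM : B →ₗ[ℂ] ℂ) = ρ.vec ξ ξ := LinearMap.ext fun a => (hρ a).symm
  refine norm_le_of_forall_rep _ (norm_nonneg x) fun π w => ?_
  refine norm_le_of_inner (by positivity) ?_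
  nth_rewrite 2 [hvec]
  rw [← inner_tensorRep_right]
  refine (norm_inner_le_norm _ _).trans ?_
  have h1 := (tensorRep π ρ x).le_of_opNorm_le (norm_tensorRep_le π ρ x)
    (HilbertTensor.incl (w ⊗ₜ ξ))
  simp only [LinearIsometry.norm_map, TensorProduct.norm_tmul, hξ, mul_one] at h1 ⊢
  rw [mul_comm]
  exact mul_le_mul_of_nonneg_right h1 (norm_nonneg _)

/-- The slice map `φ ⊗ id : A ⊗ B → B` of a state `φ` on `A`. -/
noncomputable def sliceLeft (φ : State A) : SpatialTensor A B →L[ℂ] B :=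
  (((sliceLeftAlg (φ.toCLM : A →ₗ[ℂ] ℂ)).mkContinuous 1
    (fun x => by rw [one_mul]; exact norm_sliceLeftAlg_le φ x) :
      AlgTensor A B →L[ℂ] B)).fromCompletion

/-- The slice map `id ⊗ ψ : A ⊗ B → A` of a state `ψ` on `B`. -/
noncomputable def sliceRight (ψ : State B) : SpatialTensor A B →L[ℂ] A :=
  (((sliceRightAlg (ψ.toCLM : B →ₗ[ℂ] ℂ)).mkContinuous 1
    (fun x => by rw [one_mul]; exact norm_sliceRightAlg_le ψ x) :
      AlgTensor A B →L[ℂ] A)).fromCompletion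

theorem sliceLeft_ofAlg (φ : State A) (x : AlgTensor A B) :
    sliceLeft φ (SpatialTensor.ofAlg x) = sliceLeftAlg (φ.toCLM : A →ₗ[ℂ] ℂ) x :=
  ContinuousLinearMap.fromCompletion_apply_coe _ x

theorem sliceRight_ofAlg (ψ : State B) (x : AlgTensor A B) :
    sliceRight ψ (SpatialTensor.ofAlg x) = sliceRightAlg (ψ.toCLM : B →ₗ[ℂ] ℂ) x :=
  ContinuousLinearMap.fromCompletion_apply_coe _ x

theorem sliceLeft_tmul (φ : State A) (a : A) (b : B) :
    sliceLeft φ (SpatialTensor.tmul a b) = φ a • b := by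
  rw [SpatialTensor.tmul, sliceLeft_ofAlg, sliceLeftAlg_tmul]; rfl

theorem sliceRight_tmul (ψ : State B) (a : A) (b : B) :
    sliceRight ψ (SpatialTensor.tmul a b) = ψ b • a := by
  rw [SpatialTensor.tmul, sliceRight_ofAlg, sliceRightAlg_tmul]; rfl

/-- The functional `φ ⊗ ψ` on `A ⊗ B`, `(φ ⊗ ψ)(a ⊗ b) = φ a * ψ b`. -/
noncomputable def State.tensor (φ : State A) (ψ : State B) : SpatialTensor A B →L[ℂ] ℂ :=
  ψ.toCLM.comp (sliceLeft φ)

theorem State.tensor_tmul (φ : State A) (ψ : State B) (a : A) (b : B) :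
    φ.tensor ψ (SpatialTensor.tmul a b) = φ a * ψ b := by
  rw [State.tensor, ContinuousLinearMap.comp_apply, sliceLeft_tmul, map_smul, smul_eq_mul]

end States

/-! ### The associator -/

section Assoc

variable {A B C D : Type u} [CStarAlgebra A] [CStarAlgebra B] [CStarAlgebra C] [CStarAlgebra D]

/-- The action of a matrix over `D` on tuples of vectors of a representation of `D`. -/
noncomputable def Rep.act {ι : Type*} [Fintype ι] (ρ : Rep D) (X : CStarMatrix ι ι D)
    (h : ι → ρ.H) : ι → ρ.H :=
  fun i => ∑ j, ρ.hom (X i j) (h j)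

theorem Rep.act_mul {ι : Type*} [Fintype ι] (ρ : Rep D) (X Y : CStarMatrix ι ι D)
    (h : ι → ρ.H) : ρ.act (X * Y) h = ρ.act X (ρ.act Y h) := by
  funext i
  simp only [Rep.act, CStarMatrix.mul_apply, map_sum, map_mul, sum_apply,
    mul_apply_eq_comp]
  exact Finset.sum_comm

theorem Rep.act_neg {ι : Type*} [Fintype ι] (ρ : Rep D) (X : CStarMatrix ι ι D)
    (h : ι → ρ.H) : ρ.act (-X) h = -ρ.act X h := by
  funext i
  simp only [Rep.act, CStarMatrix.neg_apply, map_neg, neg_apply, Finset.sum_neg_distrib,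
    Pi.neg_apply]

theorem Rep.inner_act_star {ι : Type*} [Fintype ι] (ρ : Rep D) (X : CStarMatrix ι ι D)
    (g h : ι → ρ.H) : ∑ i, ⟪g i, ρ.act (star X) h i⟫_ℂ = ∑ i, ⟪ρ.act X g i, h i⟫_ℂ := by
  simp only [Rep.act, inner_sum, sum_inner, CStarMatrix.star_apply, map_star,
    ContinuousLinearMap.star_eq_adjoint, ContinuousLinearMap.adjoint_inner_right]
  exact Finset.sum_comm

theorem Rep.re_inner_act_star_mul_self {ι : Type*} [Fintype ι] (ρ : Rep D)
    (X : CStarMatrix ι ι D) (h : ι → ρ.H) :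
    (∑ i, ⟪h i, ρ.act (star X * X) h i⟫_ℂ).re = ∑ i, ‖ρ.act X h i‖ ^ 2 := by
  rw [Rep.act_mul, Rep.inner_act_star, Complex.re_sum]
  refine Finset.sum_congr rfl fun i _ => ?_
  rw [inner_self_eq_norm_sq_to_K, RCLike.ofReal_eq_complex_ofReal, ← Complex.ofReal_pow,
    Complex.ofReal_re]

theorem exists_negPart {E : Type*} [CStarAlgebra E] (W : E) (hW : IsSelfAdjoint W) :
    ∃ u s : E, star u * (W * u) = -(star s * s) ∧ (s = 0 → ∃ r, W = star r * r) := by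
  let _ : PartialOrder E := CStarAlgebra.spectralOrder E
  have _ : StarOrderedRing E := CStarAlgebra.spectralOrderedRing E
  have hu0 : (0 : E) ≤ W⁻ := CFC.negPart_nonneg W
  set u := W⁻ with hu
  have hus : star u = u := (IsSelfAdjoint.of_nonneg hu0).star_eq
  have hWu : W * u = -(u * u) := by
    have h1 : W = W⁺ - u := (CFC.posPart_sub_negPart W hW).symm
    have h2 : W⁺ * u = 0 := CFC.posPart_mul_negPart W
    calc W * u = (W⁺ - u) * u := by rw [← h1]
      _ = _ := by rw [sub_mul, h2, zero_sub]
  obtain ⟨t, ht⟩ := CStarAlgebra.nonneg_iff_eq_star_mul_self.mp hu0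
  have hs : u * (u * u) = star (t * u) * (t * u) := by
    rw [star_mul, hus]
    calc u * (u * u) = u * ((star t * t) * u) := by rw [← ht]
      _ = _ := by simp only [mul_assoc]
  refine ⟨u, t * u, ?_, fun hzero => ?_⟩
  · rw [hus, hWu, mul_neg, hs]
  have hu3 : u * (u * u) = 0 := by rw [hs, hzero, mul_zero]
  have hu2 : u * u = 0 := by
    rw [← CStarRing.star_mul_self_eq_zero_iff, star_mul, hus, mul_assoc, hu3, mul_zero]
  have hu1 : u = 0 := by
    rw [← CStarRing.star_mul_self_eq_zero_iff, hus, hu2]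
  have hW0 : 0 ≤ W := (CFC.negPart_eq_zero_iff W hW).mp hu1
  exact CStarAlgebra.nonneg_iff_eq_star_mul_self.mp hW0

/-- Positivity of a matrix over `D` can be tested on a jointly faithful family of
representations. -/
theorem Rep.re_inner_act_nonneg {ι : Type*} [Fintype ι] (P : Rep D → Prop)
    (hP : ∀ d : D, (∀ ρ, P ρ → ρ.hom d = 0) → d = 0)
    (W : CStarMatrix ι ι D) (hW : IsSelfAdjoint W)
    (hpos : ∀ ρ, P ρ → ∀ h : ι → ρ.H, 0 ≤ (∑ i, ⟪h i, ρ.act W h i⟫_ℂ).re)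
    (τ : Rep D) (h : ι → τ.H) : 0 ≤ (∑ i, ⟪h i, τ.act W h i⟫_ℂ).re := by
  classical
  obtain ⟨u, s, hs, hr⟩ : ∃ u s : CStarMatrix ι ι D, star u * (W * u) = -(star s * s) ∧
      (s = 0 → ∃ r, W = star r * r) := by
    let _ : PartialOrder D := CStarAlgebra.spectralOrder D
    have _ : StarOrderedRing D := CStarAlgebra.spectralOrderedRing D
    exact exists_negPart W hW
  have hzero : s = 0 := by
    ext i j
    refine hP _ fun ρ hρ => ?_
    ext v
    have h1 := hpos ρ hρ (ρ.act u (Pi.single j v))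
    rw [← Rep.inner_act_star, ← Rep.act_mul, ← Rep.act_mul, mul_assoc, hs, Rep.act_neg] at h1
    simp only [Pi.neg_apply, inner_neg_right, Finset.sum_neg_distrib, Complex.neg_re] at h1
    rw [Rep.re_inner_act_star_mul_self] at h1
    have h2 : ∑ i, ‖ρ.act s (Pi.single j v) i‖ ^ 2 = 0 :=
      le_antisymm (by linarith) (Finset.sum_nonneg fun _ _ => sq_nonneg _)
    rw [Finset.sum_eq_zero_iff_of_nonneg (fun _ _ => sq_nonneg _)] at h2
    have h3 := h2 i (Finset.mem_univ i)
    rw [sq_eq_zero_iff, norm_eq_zero, Rep.act, Finset.sum_eq_single j] at h3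
    · simpa using h3
    · intro k _ hk; rw [Pi.single_eq_of_ne hk, map_zero]
    · intro hj; exact absurd (Finset.mem_univ j) hj
  obtain ⟨r, hr⟩ := hr hzero
  rw [hr, Rep.re_inner_act_star_mul_self]
  exact Finset.sum_nonneg fun _ _ => sq_nonneg _

/-- The norm of `(π ⊗ τ)(y)` is controlled by the norms of `(π ⊗ ρ)(y)`, for `ρ` in a jointly
faithful family of representations. -/
theorem norm_tensorRep_le_of_faithful (P : Rep D → Prop)
    (hP : ∀ d : D, (∀ ρ, P ρ → ρ.hom d = 0) → d = 0) (π : Rep A) (y : AlgTensor A D) {M : ℝ}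
    (hM : 0 ≤ M) (hy : ∀ ρ, P ρ → ‖tensorRep π ρ y‖ ≤ M) (τ : Rep D) :
    ‖tensorRep π τ y‖ ≤ M := by
  have hq : ∀ (ρ : Rep D) (v : HilbertTensor π.H ρ.H),
      (⟪v, tensorRep π ρ (((M ^ 2 : ℝ) : ℂ) • 1 - star y * y) v⟫_ℂ).re
        = M ^ 2 * ‖v‖ ^ 2 - ‖tensorRep π ρ y v‖ ^ 2 := fun ρ v => by
    rw [map_sub, map_smul, map_one, map_mul, map_star, sub_apply, smul_apply,
      one_apply_eq_self, mul_apply_eq_comp, inner_sub_right, inner_smul_right,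
      ContinuousLinearMap.star_eq_adjoint, ContinuousLinearMap.adjoint_inner_right,
      inner_self_eq_norm_sq_to_K, inner_self_eq_norm_sq_to_K]
    simp only [RCLike.ofReal_eq_complex_ofReal, ← Complex.ofReal_pow, ← Complex.ofReal_mul,
      ← Complex.ofReal_sub, Complex.ofReal_re]
  set q : AlgTensor A D := ((M ^ 2 : ℝ) : ℂ) • 1 - star y * y with hqdef
  have hqs : star q = q := by
    rw [hqdef, star_sub, star_smul, star_one, star_mul, star_star]
    simp
  refine ContinuousLinearMap.opNorm_le_bound _ hM fun v => ?_
  refine HilbertTensor.denseRange_incl.induction_on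
    (p := fun v : HilbertTensor π.H τ.H => ‖tensorRep π τ y v‖ ≤ M * ‖v‖) v
    (isClosed_le (tensorRep π τ y).continuous.norm (continuous_const.mul continuous_norm))
    fun w => ?_
  obtain ⟨S, hS⟩ := TensorProduct.exists_finset w
  have hW : ∀ (ρ : Rep D) (h : S → ρ.H),
      ⟪HilbertTensor.incl (∑ i : S, (i.1.1 : π.H) ⊗ₜ[ℂ] h i),
        tensorRep π ρ q (HilbertTensor.incl (∑ i : S, (i.1.1 : π.H) ⊗ₜ[ℂ] h i))⟫_ℂ
      = ∑ i, ⟪h i, ρ.act (CStarMatrix.ofMatrix fun i j : S =>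
          sliceLeftAlg (π.vec i.1.1 j.1.1) q) h i⟫_ℂ := fun ρ h => by
    simp only [map_sum, sum_inner, inner_sum, Rep.act, inner_tensorRep_left]
    exact Finset.sum_comm
  have hstar : ∀ (v v' : π.H) (x : AlgTensor A D),
      star (sliceLeftAlg (π.vec v v') x) = sliceLeftAlg (π.vec v' v) (star x) := fun v v' x => by
    induction x using AlgTensor.induction with
    | zero => simp only [map_zero, star_zero]
    | add x y hx hy => simp only [map_add, star_add, hx, hy]
    | tmul a d =>
      rw [AlgTensor.star_tmul, sliceLeftAlg_tmul, sliceLeftAlg_tmul, star_smul]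
      congr 1
      simp only [Rep.vec, LinearMap.coe_mk, AddHom.coe_mk, map_star,
        ContinuousLinearMap.star_eq_adjoint, ContinuousLinearMap.adjoint_inner_right]
      exact inner_conj_symm _ _
  have key := Rep.re_inner_act_nonneg P hP (CStarMatrix.ofMatrix fun i j : S =>
      sliceLeftAlg (π.vec i.1.1 j.1.1) q) (by
        ext i j
        rw [CStarMatrix.star_apply]
        change star (sliceLeftAlg (π.vec j.1.1 i.1.1) q) = sliceLeftAlg (π.vec i.1.1 j.1.1) q
        rw [hstar, hqs]) (fun ρ hρ h => by
        rw [← hW, hq]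
        have h1 := (tensorRep π ρ y).le_of_opNorm_le (hy ρ hρ)
          (HilbertTensor.incl (∑ i : S, (i.1.1 : π.H) ⊗ₜ[ℂ] h i))
        have h2 := pow_le_pow_left₀ (norm_nonneg _) h1 2
        rw [mul_pow] at h2
        linarith) τ (fun i => i.1.2)
  rw [← hW, hq] at key
  have hw : (∑ i : S, (i.1.1 : π.H) ⊗ₜ[ℂ] i.1.2) = w := by
    rw [hS, ← Finset.sum_coe_sort S (fun i => i.1 ⊗ₜ[ℂ] i.2)]
  rw [hw] at key
  refine abs_le_of_sq_le_sq' (a := ‖tensorRep π τ y (HilbertTensor.incl w)‖) ?_ (by positivity) |>.2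
  rw [mul_pow]; linarith

end Assoc

section Assoc

variable {A B C : Type u} [CStarAlgebra A] [CStarAlgebra B] [CStarAlgebra C]

theorem norm_le_of_inner_eq {X E E' : Type*} [NormedAddCommGroup E] [InnerProductSpace ℂ E]
    [NormedAddCommGroup E'] [InnerProductSpace ℂ E'] (W : X → E) (W' : X → E')
    (hW : DenseRange W) (hn : ∀ v, ‖W' v‖ = ‖W v‖) (T : E →L[ℂ] E) (T' : E' →L[ℂ] E')
    (h : ∀ u v, ⟪W u, T (W v)⟫_ℂ = ⟪W' u, T' (W' v)⟫_ℂ) : ‖T‖ ≤ ‖T'‖ := by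
  refine ContinuousLinearMap.opNorm_le_bound _ (norm_nonneg _) fun e => ?_
  refine hW.induction_on (p := fun e => ‖T e‖ ≤ ‖T'‖ * ‖e‖) e
    (isClosed_le T.continuous.norm (continuous_const.mul continuous_norm)) fun v => ?_
  refine norm_le_of_inner (by positivity) ?_
  have key : ∀ e', ‖⟪e', T (W v)⟫_ℂ‖ ≤ ‖T'‖ * ‖W v‖ * ‖e'‖ := fun e' => by
    refine hW.induction_on (p := fun e' => ‖⟪e', T (W v)⟫_ℂ‖ ≤ ‖T'‖ * ‖W v‖ * ‖e'‖) e'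
      (isClosed_le (by fun_prop) (by fun_prop)) fun u => ?_
    rw [h, ← hn u, ← hn v]
    refine (norm_inner_le_norm _ _).trans ?_
    rw [mul_comm]
    exact mul_le_mul_of_nonneg_right (T'.le_opNorm _) (norm_nonneg _)
  exact key _

variable {H K L : Type u} [NormedAddCommGroup H] [InnerProductSpace ℂ H]
  [NormedAddCommGroup K] [InnerProductSpace ℂ K] [NormedAddCommGroup L] [InnerProductSpace ℂ L]

/-- The canonical isometry `(H ⊙ K) ⊙ L → (H ⊗ K) ⊗ L`. -/
noncomputable def HilbertTensor.inclLeft :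
    ((H ⊗[ℂ] K) ⊗[ℂ] L) →ₗᵢ[ℂ] HilbertTensor (HilbertTensor H K) L :=
  HilbertTensor.incl.comp (LinearIsometry.rTensor L HilbertTensor.incl)

/-- The canonical isometry `(H ⊙ K) ⊙ L → H ⊗ (K ⊗ L)`. -/
noncomputable def HilbertTensor.inclRight :
    ((H ⊗[ℂ] K) ⊗[ℂ] L) →ₗᵢ[ℂ] HilbertTensor H (HilbertTensor K L) :=
  (HilbertTensor.incl.comp (LinearIsometry.lTensor H HilbertTensor.incl)).comp
    (TensorProduct.assocIsometry ℂ H K L).toLinearIsometry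

theorem HilbertTensor.inclLeft_tmul (h : H) (k : K) (l : L) :
    inclLeft ((h ⊗ₜ[ℂ] k) ⊗ₜ[ℂ] l) = incl (incl (h ⊗ₜ k) ⊗ₜ l) := rfl

theorem HilbertTensor.inclRight_tmul (h : H) (k : K) (l : L) :
    inclRight ((h ⊗ₜ[ℂ] k) ⊗ₜ[ℂ] l) = incl (h ⊗ₜ incl (k ⊗ₜ l)) := rfl

theorem HilbertTensor.inner_inclLeft (u v : (H ⊗[ℂ] K) ⊗[ℂ] L) :
    ⟪inclLeft u, inclLeft v⟫_ℂ = ⟪u, v⟫_ℂ :=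
  (incl.inner_map_map _ _).trans ((LinearIsometry.rTensor L incl).inner_map_map u v)

theorem HilbertTensor.inner_inclRight (u v : (H ⊗[ℂ] K) ⊗[ℂ] L) :
    ⟪inclRight u, inclRight v⟫_ℂ = ⟪u, v⟫_ℂ :=
  (incl.inner_map_map _ _).trans (((LinearIsometry.lTensor H incl).inner_map_map _ _).trans
    (TensorProduct.inner_assoc_assoc u v))

theorem HilbertTensor.denseRange_inclRight :
    DenseRange (inclRight : ((H ⊗[ℂ] K) ⊗[ℂ] L) → HilbertTensor H (HilbertTensor K L)) := by
  let R : Submodule ℂ (HilbertTensor H (HilbertTensor K L)) :=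
    (LinearMap.range (inclRight : ((H ⊗[ℂ] K) ⊗[ℂ] L) →ₗᵢ[ℂ] _).toLinearMap).topologicalClosure
  have hRc : IsClosed (R : Set (HilbertTensor H (HilbertTensor K L))) :=
    Submodule.isClosed_topologicalClosure _
  have hR : ∀ v, inclRight v ∈ R := fun v =>
    Submodule.le_topologicalClosure _ ⟨v, rfl⟩
  have h1 : ∀ (h : H) (z : HilbertTensor K L), incl (h ⊗ₜ[ℂ] z) ∈ R := fun h z => by
    refine denseRange_incl.induction_on (p := fun z => incl (h ⊗ₜ[ℂ] z) ∈ R) z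
      (hRc.preimage (incl.continuous.comp (TensorProduct.continuous_tmul.comp
        (continuous_const.prodMk continuous_id)))) fun w => ?_
    induction w using TensorProduct.induction_on with
    | zero => simp
    | add x y hx hy => rw [map_add, TensorProduct.tmul_add, map_add]; exact R.add_mem hx hy
    | tmul k l => rw [← inclRight_tmul]; exact hR _
  have h2 : ∀ x, x ∈ R := fun x => by
    refine denseRange_incl.induction_on (p := fun x => x ∈ R) x hRc fun w => ?_
    induction w using TensorProduct.induction_on with
    | zero => simp
    | add x y hx hy => rw [map_add]; exact R.add_mem hx hy
    | tmul h z => exact h1 h z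
  intro x
  exact h2 x

theorem HilbertTensor.op_inclRight (S : H →L[ℂ] H) (T : K →L[ℂ] K) (R : L →L[ℂ] L)
    (v : (H ⊗[ℂ] K) ⊗[ℂ] L) :
    op S (op T R) (inclRight v) = inclRight (TensorProduct.mapL (TensorProduct.mapL S T) R v) := by
  induction v using TensorProduct.induction_on with
  | zero => simp only [map_zero, LinearIsometry.map_zero]
  | add x y hx hy => rw [map_add, map_add, map_add, map_add, hx, hy]
  | tmul w l =>
    induction w using TensorProduct.induction_on with
    | zero => simp only [TensorProduct.zero_tmul, map_zero, LinearIsometry.map_zero]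
    | add x y hx hy =>
      rw [TensorProduct.add_tmul, map_add, map_add, map_add, map_add, hx, hy]
    | tmul h k =>
      rw [inclRight_tmul, op_tmul, op_tmul, TensorProduct.mapL_tmul, TensorProduct.mapL_tmul,
        inclRight_tmul]

theorem HilbertTensor.op_inclLeft (S : H →L[ℂ] H) (T : K →L[ℂ] K) (R : L →L[ℂ] L)
    (v : (H ⊗[ℂ] K) ⊗[ℂ] L) :
    op (op S T) R (inclLeft v) = inclLeft (TensorProduct.mapL (TensorProduct.mapL S T) R v) := by
  induction v using TensorProduct.induction_on with
  | zero => simp only [map_zero, LinearIsometry.map_zero]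
  | add x y hx hy => rw [map_add, map_add, map_add, map_add, hx, hy]
  | tmul w l =>
    induction w using TensorProduct.induction_on with
    | zero => simp only [TensorProduct.zero_tmul, map_zero, LinearIsometry.map_zero]
    | add x y hx hy =>
      rw [TensorProduct.add_tmul, map_add, map_add, map_add, map_add, hx, hy]
    | tmul h k =>
      rw [inclLeft_tmul, op_tmul, op_tmul, TensorProduct.mapL_tmul, TensorProduct.mapL_tmul,
        inclLeft_tmul]

namespace SpatialTensor

theorem commute_assoc (z : SpatialTensor A B) (c : C) :
    Commute (map (StarAlgHom.id ℂ A) (inl : B →⋆ₐ[ℂ] SpatialTensor B C) z)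
      ((inr : SpatialTensor B C →⋆ₐ[ℂ] SpatialTensor A (SpatialTensor B C)).comp inr c) := by
  have hc := continuous_hom (map (StarAlgHom.id ℂ A) (inl : B →⋆ₐ[ℂ] SpatialTensor B C))
  refine induction_ofAlg (p := fun z => map (StarAlgHom.id ℂ A) (inl : B →⋆ₐ[ℂ] SpatialTensor B C) z
    * ((inr : SpatialTensor B C →⋆ₐ[ℂ] SpatialTensor A (SpatialTensor B C)).comp inr c)
    = ((inr : SpatialTensor B C →⋆ₐ[ℂ] SpatialTensor A (SpatialTensor B C)).comp inr c)
    * map (StarAlgHom.id ℂ A) (inl : B →⋆ₐ[ℂ] SpatialTensor B C) z)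
    (isClosed_eq (hc.mul continuous_const) (continuous_const.mul hc)) (fun x => ?_) z
  induction x using AlgTensor.induction with
  | zero => simp only [map_zero, zero_mul, mul_zero]
  | add x y hx hy => simp only [map_add, add_mul, mul_add, hx, hy]
  | tmul a b =>
    change map _ _ (tmul a b) * _ = _ * map _ _ (tmul a b)
    rw [map_tmul, ← inl_mul_inr, StarAlgHom.comp_apply]
    have h1 : Commute (inl (StarAlgHom.id ℂ A a) : SpatialTensor A (SpatialTensor B C))
        (inr (inr c)) := (inl_mul_inr _ _).trans (inr_mul_inl _ _).symm
    have h2 : Commute (inr (inl b) : SpatialTensor A (SpatialTensor B C)) (inr (inr c)) := by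
      have h3 : Commute (inl b : SpatialTensor B C) (inr c) :=
        (inl_mul_inr _ _).trans (inr_mul_inl _ _).symm
      exact h3.map (inr : SpatialTensor B C →⋆ₐ[ℂ] SpatialTensor A (SpatialTensor B C))
    exact h1.mul_left h2

/-- The ⋆-homomorphism `(A ⊗ B) ⊙ C → A ⊗ (B ⊗ C)`. -/
noncomputable def assocAlg :
    AlgTensor (SpatialTensor A B) C →⋆ₐ[ℂ] SpatialTensor A (SpatialTensor B C) :=
  AlgTensor.lift (map (StarAlgHom.id ℂ A) inl) (inr.comp inr) commute_assoc

theorem assocAlg_tmul (a : A) (b : B) (c : C) :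
    assocAlg (AlgTensor.tmul (tmul a b) c) = tmul a (tmul b c) := by
  refine (AlgTensor.lift_tmul _ _ _ _ _).trans ?_
  rw [map_tmul, ← inl_mul_inr, StarAlgHom.comp_apply, mul_assoc, ← map_mul, inl_mul_inr,
    inl_mul_inr]
  rfl

theorem inner_assocAlg (π : Rep A) (ρ : Rep B) (σ : Rep C)
    (x : AlgTensor (SpatialTensor A B) C) (u v : (π.H ⊗[ℂ] ρ.H) ⊗[ℂ] σ.H) :
    ⟪HilbertTensor.inclRight u, (rep π (rep ρ σ)).hom (assocAlg x) (HilbertTensor.inclRight v)⟫_ℂ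
      = ⟪HilbertTensor.inclLeft u, tensorRep (rep π ρ) σ x (HilbertTensor.inclLeft v)⟫_ℂ := by
  induction x using AlgTensor.induction with
  | zero => simp only [map_zero, zero_apply, inner_zero_right]
  | add x y hx hy => simp only [map_add, add_apply, inner_add_right, hx, hy]
  | tmul z c =>
    have hL : Continuous fun z : SpatialTensor A B =>
        (rep π (rep ρ σ)).hom (assocAlg (AlgTensor.tmul z c)) := by
      have h1 : ∀ z : SpatialTensor A B, assocAlg (AlgTensor.tmul z c)
          = map (StarAlgHom.id ℂ A) (inl : B →⋆ₐ[ℂ] SpatialTensor B C) z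
            * (inr : SpatialTensor B C →⋆ₐ[ℂ] SpatialTensor A (SpatialTensor B C)).comp inr c :=
        fun z => AlgTensor.lift_tmul _ _ _ _ _
      simp only [h1]
      exact (continuous_hom _).comp ((continuous_hom _).mul continuous_const)
    have hR : Continuous fun z : SpatialTensor A B =>
        tensorRep (rep π ρ) σ (AlgTensor.tmul z c) := by
      have h1 : ∀ z : SpatialTensor A B, tensorRep (rep π ρ) σ (AlgTensor.tmul z c)
          = repLeft (rep π ρ) σ.H z * repRight (rep π ρ).H σ c :=
        fun z => AlgTensor.lift_tmul _ _ _ _ _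
      simp only [h1]
      exact (continuous_hom _).mul continuous_const
    refine induction_ofAlg (p := fun z : SpatialTensor A B =>
      ⟪HilbertTensor.inclRight u, (rep π (rep ρ σ)).hom (assocAlg (AlgTensor.tmul z c))
        (HilbertTensor.inclRight v)⟫_ℂ = ⟪HilbertTensor.inclLeft u,
          tensorRep (rep π ρ) σ (AlgTensor.tmul z c) (HilbertTensor.inclLeft v)⟫_ℂ)
      (isClosed_eq (continuous_const.inner (hL.clm_apply continuous_const))
        (continuous_const.inner (hR.clm_apply continuous_const))) (fun y => ?_) z
    induction y using AlgTensor.induction with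
    | zero =>
      have h0 : AlgTensor.tmul (0 : SpatialTensor A B) c = 0 := by
        rw [← zero_smul ℂ (0 : SpatialTensor A B), AlgTensor.smul_tmul', zero_smul]
      rw [map_zero, h0, map_zero, map_zero, map_zero, zero_apply, zero_apply, inner_zero_right,
        inner_zero_right]
    | add x y hx hy =>
      simp only [map_add, AlgTensor.add_tmul, add_apply, inner_add_right, hx, hy]
    | tmul a b =>
      change ⟪_, (rep π (rep ρ σ)).hom (assocAlg (AlgTensor.tmul (tmul a b) c)) _⟫_ℂ
        = ⟪_, tensorRep (rep π ρ) σ (AlgTensor.tmul (tmul a b) c) _⟫_ℂ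
      have e1 : (rep π (rep ρ σ)).hom (assocAlg (AlgTensor.tmul (tmul a b) c))
          = HilbertTensor.op (π.hom a) (HilbertTensor.op (ρ.hom b) (σ.hom c)) := by
        rw [assocAlg_tmul, tmul, rep_ofAlg, tensorRep_tmul, tmul, rep_ofAlg, tensorRep_tmul]
      have e2 : tensorRep (rep π ρ) σ (AlgTensor.tmul (tmul a b) c)
          = HilbertTensor.op (HilbertTensor.op (π.hom a) (ρ.hom b)) (σ.hom c) := by
        rw [tensorRep_tmul, tmul, rep_ofAlg, tensorRep_tmul]
      rw [e1, e2]
      have k1 := HilbertTensor.op_inclRight (π.hom a) (ρ.hom b) (σ.hom c) v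
      have k2 := HilbertTensor.op_inclLeft (π.hom a) (ρ.hom b) (σ.hom c) v
      refine (congrArg (fun e => ⟪HilbertTensor.inclRight u, e⟫_ℂ) k1).trans ?_
      refine Eq.trans ?_ (congrArg (fun e => ⟪HilbertTensor.inclLeft u, e⟫_ℂ) k2).symm
      exact (HilbertTensor.inner_inclRight (H := π.H) (K := ρ.H) (L := σ.H) _ _).trans
        (HilbertTensor.inner_inclLeft (H := π.H) (K := ρ.H) (L := σ.H) _ _).symm

theorem eq_zero_of_forall_rep (d : SpatialTensor B C)
    (h : ∀ ρ' : Rep (SpatialTensor B C), (∃ ρ σ, ρ' = rep ρ σ) → ρ'.hom d = 0) : d = 0 := by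
  rw [← norm_le_zero_iff]
  exact norm_le_of_forall_rep d le_rfl fun ρ σ => by rw [h _ ⟨ρ, σ, rfl⟩, norm_zero]

theorem norm_assocAlg_le (x : AlgTensor (SpatialTensor A B) C) : ‖assocAlg x‖ ≤ ‖x‖ := by
  refine norm_le_of_forall_rep _ (norm_nonneg x) fun π τ => ?_
  refine le_of_forall_pos_le_add fun ε hε => ?_
  obtain ⟨y, hy⟩ := Metric.denseRange_iff.mp denseRange_ofAlg (assocAlg x) (ε / 2) (half_pos hε)
  rw [dist_eq_norm] at hy
  have h1 : ‖tensorRep π τ y‖ ≤ ‖x‖ + ε / 2 := by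
    refine norm_tensorRep_le_of_faithful (fun ρ' => ∃ ρ σ, ρ' = rep ρ σ) eq_zero_of_forall_rep
      π y (by positivity) ?_ τ
    rintro _ ⟨ρ, σ, rfl⟩
    have h2 : tensorRep π (rep ρ σ) y = (rep π (rep ρ σ)).hom (assocAlg x)
        - (rep π (rep ρ σ)).hom (assocAlg x - ofAlg y) := by
      rw [map_sub, sub_sub_cancel, rep_ofAlg]
    rw [h2]
    refine (norm_sub_le _ _).trans (add_le_add ?_
      ((NonUnitalStarAlgHom.norm_apply_le _ _).trans hy.le))
    refine (norm_le_of_inner_eq (HilbertTensor.inclRight) (HilbertTensor.inclLeft)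
      HilbertTensor.denseRange_inclRight (fun v => by
        rw [LinearIsometry.norm_map, LinearIsometry.norm_map]) _ _
      (fun u v => inner_assocAlg π ρ σ x u v)).trans ?_
    exact norm_tensorRep_le _ _ _
  have h3 : (rep π τ).hom (assocAlg x)
      = (rep π τ).hom (assocAlg x - ofAlg y) + (rep π τ).hom (ofAlg y) := by
    rw [← map_add, sub_add_cancel]
  rw [h3]
  refine (norm_add_le _ _).trans ?_
  rw [rep_ofAlg]
  have h4 := (NonUnitalStarAlgHom.norm_apply_le (rep π τ).hom (assocAlg x - ofAlg y)).trans hy.le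
  exact (add_le_add h4 h1).trans (le_of_eq (by ring))

/-- The canonical isomorphism `(A ⊗ B) ⊗ C → A ⊗ (B ⊗ C)`, `(a ⊗ b) ⊗ c ↦ a ⊗ (b ⊗ c)`. -/
noncomputable def assoc :
    SpatialTensor (SpatialTensor A B) C →⋆ₐ[ℂ] SpatialTensor A (SpatialTensor B C) :=
  extend assocAlg norm_assocAlg_le

theorem assoc_tmul (a : A) (b : B) (c : C) :
    assoc (tmul (tmul a b) c) = tmul a (tmul b c) := by
  rw [tmul, assoc, extend_ofAlg, assocAlg_tmul]

end SpatialTensor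
end Assoc

/-! ### Compact quantum groups -/

section QuantumGroups

variable {A : Type u} [CStarAlgebra A]

/-- `(A, Δ)` is a compact quantum group: the coproduct `Δ` is a coassociative unital
⋆-homomorphism with values in the spatial tensor product, and both `(1 ⊗ A) Δ(A)` and
`(A ⊗ 1) Δ(A)` span dense subspaces of `A ⊗ A`. -/
structure IsCompactQuantumGroup (Δ : A →⋆ₐ[ℂ] SpatialTensor A A) : Prop where
  coassoc : ∀ a, SpatialTensor.assoc (SpatialTensor.map Δ (StarAlgHom.id ℂ A) (Δ a))
    = SpatialTensor.map (StarAlgHom.id ℂ A) Δ (Δ a)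
  dense_right : Dense (Submodule.span ℂ {x : SpatialTensor A A |
    ∃ a b : A, x = SpatialTensor.tmul 1 a * Δ b} : Set (SpatialTensor A A))
  dense_left : Dense (Submodule.span ℂ {x : SpatialTensor A A |
    ∃ a b : A, x = SpatialTensor.tmul a 1 * Δ b} : Set (SpatialTensor A A))

/-- `h` is the Haar state: `(h ⊗ id)(Δ a) = (id ⊗ h)(Δ a) = h(a) 1`. -/
def IsHaarState (Δ : A →⋆ₐ[ℂ] SpatialTensor A A) (h : State A) : Prop :=
  ∀ a, sliceLeft h (Δ a) = h a • (1 : A) ∧ sliceRight h (Δ a) = h a • (1 : A)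

/-- `φ` is an idempotent state: `(φ ⊗ φ) ∘ Δ = φ`. -/
def IsIdempotentState (Δ : A →⋆ₐ[ℂ] SpatialTensor A A) (φ : State A) : Prop :=
  ∀ a, φ.tensor φ (Δ a) = φ a

/-- A quantum subgroup `(B, j)` of `(A, Δ)`: a compact quantum group `(B, Δ_B)` with a surjective
unital ⋆-homomorphism `j : A → B` such that `Δ_B ∘ j = (j ⊗ j) ∘ Δ`. -/
structure QuantumSubgroup (Δ : A →⋆ₐ[ℂ] SpatialTensor A A) where
  B : Type u
  [cstar : CStarAlgebra B]
  comul : B →⋆ₐ[ℂ] SpatialTensor B B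
  isCompactQuantumGroup : IsCompactQuantumGroup comul
  j : A →⋆ₐ[ℂ] B
  surjective : Function.Surjective j
  comul_j : ∀ a, comul (j a) = SpatialTensor.map j j (Δ a)

attribute [instance] QuantumSubgroup.cstar

/-- `φ` is the Haar state on the quantum subgroup `S = (B, j)`, with `h` as Haar state of `B`:
`φ = h ∘ j`. -/
def QuantumSubgroup.Induces {Δ : A →⋆ₐ[ℂ] SpatialTensor A A} (S : QuantumSubgroup Δ)
    (h : State S.B) (φ : State A) : Prop :=
  IsHaarState S.comul h ∧ ∀ a, φ a = h (S.j a)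

/-- `φ` is a Haar idempotent: the Haar state on some quantum subgroup. -/
def IsHaarIdempotent (Δ : A →⋆ₐ[ℂ] SpatialTensor A A) (φ : State A) : Prop :=
  ∃ (S : QuantumSubgroup Δ) (h : State S.B), S.Induces h φ

/-- The null space `N_φ = {a | φ(a⋆ a) = 0}`. -/
def nullSpace (φ : State A) : Set A := {a | φ (star a * a) = 0}

/-- A state is faithful if `φ(a⋆ a) = 0` only for `a = 0`. -/
def State.IsFaithful (φ : State A) : Prop := ∀ a, φ (star a * a) = 0 → a = 0

/-- The surjection `j : A → B` exhibits `B` as the quotient C⋆-algebra `A / N`. -/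
structure IsQuotientMap {B : Type u} [CStarAlgebra B] (j : A →⋆ₐ[ℂ] B) (N : Set A) : Prop where
  surjective : Function.Surjective j
  ker : ∀ a, j a = 0 ↔ a ∈ N
  norm_eq : ∀ a, ‖j a‖ = Metric.infDist a N

end QuantumGroups

end CQG

/-! By Cauchy–Schwarz `N_φ` is a left ideal, and for such a null space two-sidedness and
selfadjointness amount to the same condition (`exists_twoSidedIdeal_iff`). The substance is that
Haar idempotents have selfadjoint null spaces and that, conversely, a selfadjoint null space can be
divided out.

If `φ = h ∘ j` with `h` a Haar state, it suffices that the null space of `h` is selfadjoint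
(`haar_star_mul_eq_zero`). Let `h(xx*) = 0`. Right invariance and the density of `Δ(A)(A ⊗ 1)` give
`(id ⊗ h)(Δ(x)z) = 0` for all `z`. Put `s = (h ⊗ id)((x* ⊗ 1)Δ(y))`. Slicing the outer legs of a
threefold product by `h` in two ways shows that `h(s·c) = 0` whenever `c` is a slice `(h ⊗ id)((b ⊗
1)Δ(a))`. These slices span a dense subspace, so `(h ⊗ h)((x* ⊗ 1)Δ(y)(1 ⊗ c)) = 0` for all `y, c`.
By density `x ⊗ 1` can replace `Δ(y)(1 ⊗ c)`, which gives `h(x*x) = 0`.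

Conversely, if `N_φ` is selfadjoint, it is the kernel of the GNS representation. The image is a
C⋆-algebra with the quotient norm, because elements of the image lift without increase of norm, and
`φ` descends to a faithful state `h` on it. The product `h ⊗ h` is again faithful on the spatial
tensor product (`State.IsFaithful.tensor`), and this is used twice. First, `(h ⊗ h)(|(j ⊗ j)Δ(a)|²)
= φ(a*a)` by idempotency, where `|w|² = w*w`, so the coproduct descends. Second, a faithful
idempotent state is the Haar state (`isHaarState_of_isFaithful`): if `e` is fixed by `(id ⊗ h)Δ`,
then `(h ⊗ h)(|Δ(e) - e ⊗ 1|²) = 0`, hence `Δ(e) = e ⊗ 1`, and density of slices turns this into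
invariance of `h`.

Uniqueness holds because a faithful Haar state inducing `φ` forces the kernel of the subgroup map to
be `N_φ`. -/

namespace CQG

/-! ### Calculus of slice maps and of the associator -/

section Slices

variable {A B C D : Type u} [CStarAlgebra A] [CStarAlgebra B] [CStarAlgebra C] [CStarAlgebra D]

namespace SpatialTensor

theorem tmul_eq_inl_mul_inr (a : A) (b : B) : tmul a b = inl a * inr b := (inl_mul_inr a b).symm

theorem inl_apply (a : A) : (inl a : SpatialTensor A B) = tmul a 1 := rfl

theorem inr_apply (b : B) : (inr b : SpatialTensor A B) = tmul 1 b := rfl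

theorem tmul_mul_tmul (a a' : A) (b b' : B) :
    tmul a b * tmul a' b' = tmul (a * a') (b * b') := by
  simp only [tmul, ← map_mul, AlgTensor.tmul_mul_tmul]

theorem star_tmul (a : A) (b : B) : star (tmul a b) = tmul (star a) (star b) := by
  rw [tmul, star_ofAlg, AlgTensor.star_tmul, tmul]

theorem smul_tmul (c : ℂ) (a : A) (b : B) : tmul (c • a) b = c • tmul a b := by
  rw [tmul, AlgTensor.smul_tmul', ofAlg_smul, tmul]

theorem tmul_smul (c : ℂ) (a : A) (b : B) : tmul a (c • b) = c • tmul a b := by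
  rw [tmul, AlgTensor.tmul_smul, ofAlg_smul, tmul]

/-- A closed condition stable under addition holds on `A ⊗ B` if it holds on elementary
tensors. -/
theorem induction_tmul {p : SpatialTensor A B → Prop} (hp : IsClosed {x | p x})
    (tmul : ∀ a b, p (tmul a b)) (add : ∀ x y, p x → p y → p (x + y)) (x : SpatialTensor A B) :
    p x := by
  refine induction_ofAlg hp (fun y => ?_) x
  induction y using AlgTensor.induction with
  | zero =>
    -- Zero is itself an elementary tensor, so no separate hypothesis at `0` is needed.
    have h := tmul 0 0
    rwa [tmul_eq_inl_mul_inr, map_zero, zero_mul, ← map_zero ofAlg] at h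
  | tmul a b => exact tmul a b
  | add x y hx hy => rw [map_add]; exact add _ _ hx hy

/-- Continuous additive maps on `A ⊗ B` agree if they agree on elementary tensors. -/
theorem eq_of_forall_tmul {F : Type*} [NormedAddCommGroup F] [NormedSpace ℂ F]
    {S T : SpatialTensor A B → F} (hS : Continuous S) (hT : Continuous T)
    (hSa : ∀ x y, S (x + y) = S x + S y) (hTa : ∀ x y, T (x + y) = T x + T y)
    (h : ∀ a b, S (tmul a b) = T (tmul a b)) (x : SpatialTensor A B) : S x = T x :=
  induction_tmul (isClosed_eq hS hT) h (fun x y hx hy => by rw [hSa, hTa, hx, hy]) x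

@[fun_prop]
theorem continuous_coe_hom (f : A →⋆ₐ[ℂ] C) : Continuous (fun a => f a) := continuous_hom f

theorem map_inl (f : A →⋆ₐ[ℂ] C) (g : B →⋆ₐ[ℂ] D) (a : A) : map f g (inl a) = inl (f a) := by
  rw [inl_apply, map_tmul, map_one, inl_apply]

theorem map_inr (f : A →⋆ₐ[ℂ] C) (g : B →⋆ₐ[ℂ] D) (b : B) : map f g (inr b) = inr (g b) := by
  rw [inr_apply, map_tmul, map_one, inr_apply]

theorem map_map {E F : Type u} [CStarAlgebra E] [CStarAlgebra F] (f : A →⋆ₐ[ℂ] C)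
    (g : B →⋆ₐ[ℂ] D) (f' : C →⋆ₐ[ℂ] E) (g' : D →⋆ₐ[ℂ] F) (x : SpatialTensor A B) :
    map f' g' (map f g x) = map (f'.comp f) (g'.comp g) x := by
  refine eq_of_forall_tmul (S := fun x => map f' g' (map f g x))
    (T := fun x => map (f'.comp f) (g'.comp g) x) (by fun_prop) (by fun_prop)
    (fun _ _ => by simp only [map_add]) (fun _ _ => by simp only [map_add]) (fun a b => ?_) x
  simp only [map_tmul, StarAlgHom.comp_apply]

/-- The first leg `z` need not be elementary here. Writing the value as a product of ⋆-homomorphisms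
makes continuity and multiplicativity in `z` available. -/
theorem assoc_tmul_eq (z : SpatialTensor A B) (c : C) :
    assoc (tmul z c) = map (StarAlgHom.id ℂ A) inl z * inr (inr c) := by
  refine eq_of_forall_tmul (S := fun z => assoc (tmul z c))
    (T := fun z => map (StarAlgHom.id ℂ A) inl z * inr (inr c)) ?_ (by fun_prop) ?_
    (fun _ _ => by simp only [map_add, add_mul]) (fun a b => ?_) z
  · simp only [tmul_eq_inl_mul_inr]; fun_prop
  · intro x y; simp only [tmul_eq_inl_mul_inr, map_add, add_mul]
  · simp only [assoc_tmul, map_tmul, StarAlgHom.coe_id, id_eq, inr_apply, inl_apply,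
      tmul_mul_tmul, mul_one, one_mul]

/-- Naturality of the associator, by which coassociativity passes to quotients. -/
theorem assoc_map {E F : Type u} [CStarAlgebra E] [CStarAlgebra F] (f : A →⋆ₐ[ℂ] D)
    (g : B →⋆ₐ[ℂ] E) (k : C →⋆ₐ[ℂ] F) (w : SpatialTensor (SpatialTensor A B) C) :
    assoc (map (map f g) k w) = map f (map g k) (assoc w) := by
  refine eq_of_forall_tmul (S := fun w => assoc (map (map f g) k w))
    (T := fun w => map f (map g k) (assoc w)) (by fun_prop) (by fun_prop)
    (fun _ _ => by simp only [map_add]) (fun _ _ => by simp only [map_add]) (fun z c => ?_) w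
  rw [map_tmul, assoc_tmul_eq, assoc_tmul_eq, map_mul, map_inr, map_inr, map_map, map_map]
  have h : (inl : E →⋆ₐ[ℂ] SpatialTensor E F).comp g = (map g k).comp inl :=
    StarAlgHom.ext fun b => (map_inl g k b).symm
  rw [h]
  rfl

end SpatialTensor

open SpatialTensor

/-- A slice map is a bimodule map over the leg that it leaves untouched. This and the next three
lemmas are its left and right versions for the two slices. -/
theorem sliceLeft_inr_mul (φ : State A) (b : B) (z : SpatialTensor A B) :
    sliceLeft φ (inr b * z) = b * sliceLeft φ z :=
  eq_of_forall_tmul (S := fun z => sliceLeft φ (inr b * z)) (T := fun z => b * sliceLeft φ z)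
    (by fun_prop) (by fun_prop) (fun _ _ => by simp only [map_add, mul_add])
    (fun _ _ => by simp only [map_add, mul_add])
    (fun a c => by simp only [inr_apply, tmul_mul_tmul, one_mul, sliceLeft_tmul,
      mul_smul_comm]) z

theorem sliceLeft_mul_inr (φ : State A) (z : SpatialTensor A B) (b : B) :
    sliceLeft φ (z * inr b) = sliceLeft φ z * b :=
  eq_of_forall_tmul (S := fun z => sliceLeft φ (z * inr b)) (T := fun z => sliceLeft φ z * b)
    (by fun_prop) (by fun_prop) (fun _ _ => by simp only [map_add, add_mul])
    (fun _ _ => by simp only [map_add, add_mul])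
    (fun a c => by simp only [inr_apply, tmul_mul_tmul, mul_one, sliceLeft_tmul,
      smul_mul_assoc]) z

theorem sliceRight_inl_mul (ψ : State B) (a : A) (z : SpatialTensor A B) :
    sliceRight ψ (inl a * z) = a * sliceRight ψ z :=
  eq_of_forall_tmul (S := fun z => sliceRight ψ (inl a * z)) (T := fun z => a * sliceRight ψ z)
    (by fun_prop) (by fun_prop) (fun _ _ => by simp only [map_add, mul_add])
    (fun _ _ => by simp only [map_add, mul_add])
    (fun a c => by simp only [inl_apply, tmul_mul_tmul, one_mul, sliceRight_tmul,
      mul_smul_comm]) z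

theorem sliceRight_mul_inl (ψ : State B) (z : SpatialTensor A B) (a : A) :
    sliceRight ψ (z * inl a) = sliceRight ψ z * a :=
  eq_of_forall_tmul (S := fun z => sliceRight ψ (z * inl a)) (T := fun z => sliceRight ψ z * a)
    (by fun_prop) (by fun_prop) (fun _ _ => by simp only [map_add, add_mul])
    (fun _ _ => by simp only [map_add, add_mul])
    (fun a c => by simp only [inl_apply, tmul_mul_tmul, mul_one, sliceRight_tmul,
      smul_mul_assoc]) z

/-- Fubini: the functional `φ ⊗ ψ` can be computed leg by leg in either order. -/
theorem apply_sliceLeft (φ : State A) (ψ : State B) (z : SpatialTensor A B) :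
    ψ (sliceLeft φ z) = φ (sliceRight ψ z) :=
  eq_of_forall_tmul (S := fun z => ψ (sliceLeft φ z)) (T := fun z => φ (sliceRight ψ z))
    (by fun_prop) (by fun_prop) (fun _ _ => by simp only [map_add])
    (fun _ _ => by simp only [map_add])
    (fun a c => by simp only [sliceLeft_tmul, sliceRight_tmul, map_smul, smul_eq_mul,
      mul_comm]) z

theorem State.tensor_apply (φ : State A) (ψ : State B) (z : SpatialTensor A B) :
    φ.tensor ψ z = ψ (sliceLeft φ z) := rfl

theorem State.map_star (φ : State A) (a : A) : φ (star a) = star (φ a) := by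
  obtain ⟨π, ξ, -, h⟩ := φ.exists_rep
  rw [← h, ← h, StarHomClass.map_star, ContinuousLinearMap.star_eq_adjoint,
    ContinuousLinearMap.adjoint_inner_right]
  exact (inner_conj_symm _ _).symm

theorem State.apply_one (φ : State A) : φ (1 : A) = 1 := φ.map_one'

/-- The Cauchy–Schwarz inequality in the degenerate case. -/
theorem State.mul_eq_zero (φ : State A) {a : A} (ha : φ (star a * a) = 0) (b : A) :
    φ (b * a) = 0 := by
  obtain ⟨π, ξ, -, h⟩ := φ.exists_rep
  -- In the GNS representation the hypothesis reads `‖π(a)ξ‖² = 0`, so `π(b)π(a)ξ = 0` for every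
  -- `b`.
  rw [← h, map_mul, StarHomClass.map_star, mul_apply_eq_comp, ContinuousLinearMap.star_eq_adjoint,
    ContinuousLinearMap.adjoint_inner_right, inner_self_eq_zero] at ha
  rw [← h, map_mul, mul_apply_eq_comp, ha, map_zero, inner_zero_right]

theorem State.mul_eq_zero_of_mul_star (φ : State A) {a : A} (ha : φ (a * star a) = 0) (b : A) :
    φ (a * b) = 0 := by
  have h := φ.mul_eq_zero (a := star a) (by rwa [star_star]) (star b)
  rwa [← star_mul, φ.map_star, star_eq_zero] at h

theorem sliceLeft_star (φ : State A) (z : SpatialTensor A B) :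
    sliceLeft φ (star z) = star (sliceLeft φ z) :=
  eq_of_forall_tmul (S := fun z => sliceLeft φ (star z)) (T := fun z => star (sliceLeft φ z))
    (by fun_prop) (by fun_prop) (fun _ _ => by simp only [map_add, star_add])
    (fun _ _ => by simp only [map_add, star_add])
    (fun a c => by simp only [star_tmul, sliceLeft_tmul, star_smul, State.map_star]) z

theorem sliceRight_star (ψ : State B) (z : SpatialTensor A B) :
    sliceRight ψ (star z) = star (sliceRight ψ z) :=
  eq_of_forall_tmul (S := fun z => sliceRight ψ (star z)) (T := fun z => star (sliceRight ψ z))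
    (by fun_prop) (by fun_prop) (fun _ _ => by simp only [map_add, star_add])
    (fun _ _ => by simp only [map_add, star_add])
    (fun a c => by simp only [star_tmul, sliceRight_tmul, star_smul, State.map_star]) z

theorem sliceLeft_map (φ : State A) (ψ : State C) (f : A →⋆ₐ[ℂ] C) (g : B →⋆ₐ[ℂ] D)
    (h : ∀ a, φ a = ψ (f a)) (z : SpatialTensor A B) :
    sliceLeft ψ (map f g z) = g (sliceLeft φ z) :=
  eq_of_forall_tmul (S := fun z => sliceLeft ψ (map f g z)) (T := fun z => g (sliceLeft φ z))
    (by fun_prop) (by fun_prop) (fun _ _ => by simp only [map_add])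
    (fun _ _ => by simp only [map_add])
    (fun a c => by simp only [map_tmul, sliceLeft_tmul, map_smul, h]) z

theorem sliceRight_map (φ : State B) (ψ : State D) (f : A →⋆ₐ[ℂ] C) (g : B →⋆ₐ[ℂ] D)
    (h : ∀ b, φ b = ψ (g b)) (z : SpatialTensor A B) :
    sliceRight ψ (map f g z) = f (sliceRight φ z) :=
  eq_of_forall_tmul (S := fun z => sliceRight ψ (map f g z)) (T := fun z => f (sliceRight φ z))
    (by fun_prop) (by fun_prop) (fun _ _ => by simp only [map_add])
    (fun _ _ => by simp only [map_add])
    (fun a c => by simp only [map_tmul, sliceRight_tmul, map_smul, h]) z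

theorem sliceLeft_assoc_tmul (φ : State A) (z : SpatialTensor A B) (c : C) :
    sliceLeft φ (assoc (tmul z c)) = tmul (sliceLeft φ z) c := by
  rw [assoc_tmul_eq, sliceLeft_mul_inr, sliceLeft_map φ φ _ _ (fun _ => rfl), inl_mul_inr]

/-- Slices of the two outer legs commute. Together with coassociativity this expresses associativity
of convolution. -/
theorem sliceRight_sliceLeft_assoc (φ : State A) (ψ : State C)
    (w : SpatialTensor (SpatialTensor A B) C) :
    sliceRight ψ (sliceLeft φ (assoc w)) = sliceLeft φ (sliceRight ψ w) :=
  eq_of_forall_tmul (S := fun w => sliceRight ψ (sliceLeft φ (assoc w)))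
    (T := fun w => sliceLeft φ (sliceRight ψ w))
    (by fun_prop) (by fun_prop) (fun _ _ => by simp only [map_add])
    (fun _ _ => by simp only [map_add])
    (fun z c => by simp only [sliceLeft_assoc_tmul, sliceRight_tmul, map_smul]) w

end Slices

end CQG
namespace CQG

open SpatialTensor

/-! ### The null space of a Haar state is selfadjoint -/

section HaarNullSpace

variable {A : Type u} [CStarAlgebra A] {Δ : A →⋆ₐ[ℂ] SpatialTensor A A}

/-- A continuous linear map vanishing on products of a fixed kind vanishes if these products span
a dense subspace. -/
theorem clm_eq_zero_of_dense {E F : Type*} [NormedAddCommGroup E] [NormedSpace ℂ E]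
    [NormedAddCommGroup F] [NormedSpace ℂ F] {s : Set E}
    (hs : Dense (Submodule.span ℂ s : Set E)) (T : E →L[ℂ] F) (h : ∀ x ∈ s, T x = 0) (x : E) :
    T x = 0 := by
  have := ContinuousLinearMap.ext_on hs (f := T) (g := 0) (fun y hy => by simpa using h y hy)
  rw [this, zero_apply]

/-- The adjoints of a set with dense span have dense span. -/
theorem dense_span_star {E : Type*} [CStarAlgebra E] {s t : Set E}
    (hs : Dense (Submodule.span ℂ s : Set E)) (hst : ∀ x ∈ s, star x ∈ t) :
    Dense (Submodule.span ℂ t : Set E) := by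
  refine (star_involutive.surjective.denseRange.dense_image continuous_star hs).mono ?_
  rintro _ ⟨x, hx, rfl⟩
  induction hx using Submodule.span_induction with
  | mem x hx => exact Submodule.subset_span (hst x hx)
  | zero => simp
  | add x y _ _ hx hy => rw [star_add]; exact Submodule.add_mem _ hx hy
  | smul c x _ hx => rw [star_smul]; exact Submodule.smul_mem _ _ hx

namespace IsCompactQuantumGroup

/-- With the coproduct as the left factor, multiplication by `Δ(x)` from the left merges into
`Δ(xb)`, to which invariance applies. -/
theorem dense_left_star (hΔ : IsCompactQuantumGroup Δ) :
    Dense (Submodule.span ℂ {x : SpatialTensor A A | ∃ a b : A, x = Δ b * inl a} :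
      Set (SpatialTensor A A)) :=
  dense_span_star hΔ.dense_left (by
    rintro _ ⟨a, b, rfl⟩
    refine ⟨star a, star b, ?_⟩
    rw [star_mul, star_tmul, star_one, ← map_star]
    rfl)

theorem dense_right_star (hΔ : IsCompactQuantumGroup Δ) :
    Dense (Submodule.span ℂ {x : SpatialTensor A A | ∃ a b : A, x = Δ b * inr a} :
      Set (SpatialTensor A A)) :=
  dense_span_star hΔ.dense_right (by
    rintro _ ⟨a, b, rfl⟩
    refine ⟨star a, star b, ?_⟩
    rw [star_mul, star_tmul, star_one, ← map_star]
    rfl)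

end IsCompactQuantumGroup

/-- Left invariance `(h ⊗ id)Δ = h(·)1`, applied in the first two of three legs. -/
theorem sliceLeft_assoc_map_comul {h : State A} (hh : IsHaarState Δ h) (z : SpatialTensor A A) :
    sliceLeft h (assoc (map Δ (StarAlgHom.id ℂ A) z)) = inr (sliceLeft h z) :=
  eq_of_forall_tmul (S := fun z => sliceLeft h (assoc (map Δ (StarAlgHom.id ℂ A) z)))
    (T := fun z => inr (sliceLeft h z)) (by fun_prop) (by fun_prop)
    (fun _ _ => by simp only [map_add]) (fun _ _ => by simp only [map_add])
    (fun a b => by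
      simp only [map_tmul, sliceLeft_assoc_tmul, (hh a).1, sliceLeft_tmul, StarAlgHom.coe_id,
        id_eq, smul_tmul, map_smul, inr_apply]) z

/-- Right invariance in the last two of three legs: `h ⊗ id ⊗ h` of `(u ⊗ 1)(id ⊗ Δ)(z)` is `(h ⊗
id)(u((id ⊗ h)(z) ⊗ 1))`. -/
theorem sliceRight_sliceLeft_assoc_inl_mul {h : State A} (hh : IsHaarState Δ h)
    (u z : SpatialTensor A A) :
    sliceRight h (sliceLeft h (assoc (inl u) * map (StarAlgHom.id ℂ A) Δ z))
      = sliceLeft h (u * inl (sliceRight h z)) := by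
  -- The last two legs are an arbitrary `r`, so that the non-elementary `Δ(b)` can be inserted for
  -- it.
  have key : ∀ (p : A) (r : SpatialTensor A A),
      sliceRight h (sliceLeft h (assoc (inl u) * tmul p r))
        = sliceLeft h (u * tmul p (sliceRight h r)) := fun p r =>
    eq_of_forall_tmul (S := fun r => sliceRight h (sliceLeft h (assoc (inl u) * tmul p r)))
      (T := fun r => sliceLeft h (u * tmul p (sliceRight h r)))
      (by simp only [tmul_eq_inl_mul_inr]; fun_prop)
      (by simp only [tmul_eq_inl_mul_inr]; fun_prop)
      (fun _ _ => by simp only [tmul_eq_inl_mul_inr, map_add, mul_add])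
      (fun _ _ => by simp only [tmul_eq_inl_mul_inr, map_add, mul_add])
      (fun c d => by
        simp only [← assoc_tmul]
        simp only [← map_mul, inl_apply, tmul_mul_tmul, one_mul, sliceRight_sliceLeft_assoc,
          sliceRight_tmul, tmul_smul, mul_smul_comm]) r
  refine eq_of_forall_tmul
    (S := fun z => sliceRight h (sliceLeft h (assoc (inl u) * map (StarAlgHom.id ℂ A) Δ z)))
    (T := fun z => sliceLeft h (u * inl (sliceRight h z))) (by fun_prop) (by fun_prop)
    (fun _ _ => by simp only [map_add, mul_add]) (fun _ _ => by simp only [map_add, mul_add])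
    (fun a b => ?_) z
  simp only [map_tmul, StarAlgHom.coe_id, id_eq]
  rw [key, (hh b).2, sliceRight_tmul, tmul_smul, map_smul, inl_apply]

/-- For `x` with `h(x x⋆) = 0`, the slice `(id ⊗ h)` vanishes on `Δ(x) (A ⊗ A)`. -/
theorem sliceRight_comul_mul_eq_zero (hΔ : IsCompactQuantumGroup Δ) {h : State A}
    (hh : IsHaarState Δ h) {x : A} (hx : h (x * star x) = 0) (z : SpatialTensor A A) :
    sliceRight h (Δ x * z) = 0 := by
  refine clm_eq_zero_of_dense hΔ.dense_left_star
    ((sliceRight h).comp (ContinuousLinearMap.mul ℂ _ (Δ x))) ?_ z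
  -- On the spanning elements the slice is `(id ⊗ h)(Δ(xb)(a ⊗ 1)) = h(xb)a`, and `h(xb) = 0` by
  -- Cauchy–Schwarz.
  rintro _ ⟨a, b, rfl⟩
  rw [ContinuousLinearMap.comp_apply, ContinuousLinearMap.mul_apply', ← mul_assoc, ← map_mul,
    sliceRight_mul_inl, (hh _).2, h.mul_eq_zero_of_mul_star hx, zero_smul, zero_mul]

/-- One element of the triple tensor product is evaluated under `h ⊗ h ⊗ h` in two ways. Left
invariance yields the expression in question, right invariance yields a multiple of a vanishing
slice. -/
theorem haar_mul_sliceLeft_eq_zero (hΔ : IsCompactQuantumGroup Δ) {h : State A}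
    (hh : IsHaarState Δ h) {x : A} (hx : h (x * star x) = 0) (y a b : A) :
    h (sliceLeft h (inl (star x) * Δ y) * sliceLeft h (inl b * Δ a)) = 0 := by
  set s := sliceLeft h (inl (star x) * Δ y) with hs
  -- Coassociativity of `Δ(y)` gives `(Δ(x*) ⊗ 1)(id ⊗ Δ)Δ(y) = (Δ ⊗ id)((x* ⊗ 1)Δ(y))`, and the
  -- first leg can now be sliced by left invariance.
  have e1 : assoc (inl (inr b * Δ (star x))) * map (StarAlgHom.id ℂ A) Δ (Δ y * inr a)
      = inr (inl b) * (assoc (map Δ (StarAlgHom.id ℂ A) (inl (star x) * Δ y)) * inr (Δ a)) := by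
    rw [map_mul, map_mul, map_mul, map_inr, ← hΔ.coassoc, map_mul, map_mul, map_inl]
    have : assoc (inl (inr b : SpatialTensor A A) : SpatialTensor (SpatialTensor A A) A)
        = inr (inl b) := by
      simp only [inl_apply, inr_apply, assoc_tmul]
    rw [this]
    simp only [mul_assoc]
  have e2 := sliceRight_sliceLeft_assoc_inl_mul hh (inr b * Δ (star x)) (Δ y * inr a)
  rw [e1, sliceLeft_inr_mul, sliceLeft_mul_inr, sliceLeft_assoc_map_comul hh,
    sliceRight_inl_mul, ← hs] at e2
  have e3 := congrArg h.toCLM e2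
  rw [apply_sliceLeft h h (_ * _), sliceRight_mul_inl] at e3
  -- This is the adjoint of `(id ⊗ h)(Δ(x)(1 ⊗ b*)) = 0`.
  have e4 : sliceRight h (inr b * Δ (star x)) = 0 := by
    have := sliceRight_comul_mul_eq_zero hΔ hh hx (inr (star b))
    rwa [← star_star (Δ x * _), star_mul, sliceRight_star, star_eq_zero, ← map_star, ← map_star,
      star_star] at this
  -- The surviving side is `(h ⊗ h)((b ⊗ s)Δ(a))`, which Fubini rewrites as the claimed product
  -- under `h`.
  rw [e4, zero_mul, map_zero, ← sliceRight_inl_mul, ← apply_sliceLeft, ← mul_assoc] at e3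
  rwa [← sliceLeft_inr_mul, ← mul_assoc, inr_mul_inl, ← inl_mul_inr]

/-- The null space of the Haar state is selfadjoint. -/
theorem haar_star_mul_eq_zero (hΔ : IsCompactQuantumGroup Δ) {h : State A}
    (hh : IsHaarState Δ h) {x : A} (hx : h (x * star x) = 0) : h (star x * x) = 0 := by
  -- The functional `z ↦ h(s·(h ⊗ id)(z))` vanishes on the dense span of `(A ⊗ 1)Δ(A)`. At `1 ⊗ c`
  -- its value is `h(s·c)`.
  have h1 : ∀ y c : A, h (sliceLeft h (inl (star x) * Δ y) * c) = 0 := fun y c => by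
    have := clm_eq_zero_of_dense hΔ.dense_left ((h.toCLM.comp (ContinuousLinearMap.mul ℂ _
      (sliceLeft h (inl (star x) * Δ y)))).comp (sliceLeft h)) (by
        rintro _ ⟨b, a, rfl⟩
        exact haar_mul_sliceLeft_eq_zero hΔ hh hx y a b) (inr c)
    simpa [inr_apply, sliceLeft_tmul, h.apply_one] using this
  -- The functional `z ↦ (h ⊗ h)((x* ⊗ 1)z)` vanishes on `Δ(A)(1 ⊗ A)`. At `x ⊗ 1` its value is
  -- `h(x*x)`.
  have := clm_eq_zero_of_dense hΔ.dense_right_star ((h.toCLM.comp (sliceLeft h)).comp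
    (ContinuousLinearMap.mul ℂ _ (inl (star x)))) (by
      rintro _ ⟨c, y, rfl⟩
      simp only [ContinuousLinearMap.comp_apply, ContinuousLinearMap.mul_apply']
      rw [← mul_assoc, sliceLeft_mul_inr, h1]) (inl x)
  simpa only [ContinuousLinearMap.comp_apply, ContinuousLinearMap.mul_apply',
    inl_apply, tmul_mul_tmul, mul_one, sliceLeft_tmul, map_smul, h.apply_one, smul_eq_mul, mul_one] using this

end HaarNullSpace

end CQG
namespace CQG

open SpatialTensor

/-! ### Faithfulness of product states -/

section FaithfulTensor

variable {A B : Type u} [CStarAlgebra A] [CStarAlgebra B]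

/-- Slicing by a vector state is compression to `ξ ⊗ K`, with `K` the space of `ρ`. Positivity of
slices follows from this. -/
theorem inner_rep_left (π : Rep A) (ρ : Rep B) {φ : State A} {ξ : π.H}
    (hξ : ∀ a, ⟪ξ, π.hom a ξ⟫_ℂ = φ a) (w w' : ρ.H) (x : SpatialTensor A B) :
    ⟪HilbertTensor.incl (ξ ⊗ₜ w), (rep π ρ).hom x (HilbertTensor.incl (ξ ⊗ₜ w'))⟫_ℂ
      = ⟪w, ρ.hom (sliceLeft φ x) w'⟫_ℂ := by
  have hr : Continuous (rep π ρ).hom := continuous_hom _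
  have hρ : Continuous ρ.hom := continuous_hom _
  refine eq_of_forall_tmul (S := fun x =>
      ⟪HilbertTensor.incl (ξ ⊗ₜ w), (rep π ρ).hom x (HilbertTensor.incl (ξ ⊗ₜ w'))⟫_ℂ)
    (T := fun x => ⟪w, ρ.hom (sliceLeft φ x) w'⟫_ℂ) (by fun_prop) (by fun_prop)
    (fun _ _ => by simp only [map_add, add_apply, inner_add_right])
    (fun _ _ => by simp only [map_add, add_apply, inner_add_right]) (fun a b => ?_) x
  rw [tmul, rep_ofAlg, tensorRep_tmul, HilbertTensor.op_tmul, LinearIsometry.inner_map_map,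
    TensorProduct.inner_tmul, ← tmul, sliceLeft_tmul, map_smul, smul_apply, inner_smul_right, hξ]

theorem inner_rep_right (π : Rep A) (ρ : Rep B) {ψ : State B} {ξ : ρ.H}
    (hξ : ∀ b, ⟪ξ, ρ.hom b ξ⟫_ℂ = ψ b) (v v' : π.H) (x : SpatialTensor A B) :
    ⟪HilbertTensor.incl (v ⊗ₜ ξ), (rep π ρ).hom x (HilbertTensor.incl (v' ⊗ₜ ξ))⟫_ℂ
      = ⟪v, π.hom (sliceRight ψ x) v'⟫_ℂ := by
  have hr : Continuous (rep π ρ).hom := continuous_hom _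
  have hρ : Continuous π.hom := continuous_hom _
  refine eq_of_forall_tmul (S := fun x =>
      ⟪HilbertTensor.incl (v ⊗ₜ ξ), (rep π ρ).hom x (HilbertTensor.incl (v' ⊗ₜ ξ))⟫_ℂ)
    (T := fun x => ⟪v, π.hom (sliceRight ψ x) v'⟫_ℂ) (by fun_prop) (by fun_prop)
    (fun _ _ => by simp only [map_add, add_apply, inner_add_right])
    (fun _ _ => by simp only [map_add, add_apply, inner_add_right]) (fun a b => ?_) x
  rw [tmul, rep_ofAlg, tensorRep_tmul, HilbertTensor.op_tmul, LinearIsometry.inner_map_map,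
    TensorProduct.inner_tmul, ← tmul, sliceRight_tmul, map_smul, smul_apply, inner_smul_right, hξ,
    mul_comm]

theorem Rep.inner_star_mul_self (π : Rep A) (a : A) (v : π.H) :
    ⟪v, π.hom (star a * a) v⟫_ℂ = ((‖π.hom a v‖ ^ 2 : ℝ) : ℂ) := by
  rw [map_mul, map_star, mul_apply_eq_comp, ContinuousLinearMap.star_eq_adjoint,
    ContinuousLinearMap.adjoint_inner_right, inner_self_eq_norm_sq_to_K]
  simp

/-- An element which is positive in every representation is of the form `z⋆ z`. -/
theorem exists_eq_star_mul_self {y : A} (hy : IsSelfAdjoint y)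
    (h : ∀ (ρ : Rep A) (w : ρ.H), 0 ≤ ⟪w, ρ.hom y w⟫_ℂ) : ∃ z, y = star z * z := by
  obtain ⟨u, s, hs, hr⟩ := exists_negPart y hy
  refine hr (norm_le_zero_iff.mp (CQG.norm_le_of_forall_rep s le_rfl fun ρ v => ?_))
  -- Positivity of `y` at `ρ(u)v` says `-‖ρ(s)v‖² ≥ 0`, so every representation kills `s`.
  have h1 := h ρ (ρ.hom u v)
  rw [← ContinuousLinearMap.adjoint_inner_right, ← ContinuousLinearMap.star_eq_adjoint,
    ← map_star, ← mul_apply_eq_comp, ← mul_apply_eq_comp, ← map_mul, ← map_mul, mul_assoc, hs, map_neg,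
    neg_apply, inner_neg_right, Rep.inner_star_mul_self, ← Complex.ofReal_neg,
    Complex.zero_le_real] at h1
  have h2 : ‖ρ.hom s v‖ ^ 2 = 0 := le_antisymm (by linarith) (sq_nonneg _)
  rw [zero_mul]
  exact (pow_eq_zero_iff two_ne_zero).mp h2 |>.le

theorem exists_sliceLeft_star_mul_self (φ : State A) (x : SpatialTensor A B) :
    ∃ z, sliceLeft φ (star x * x) = star z * z := by
  obtain ⟨π, ξ, -, hξ⟩ := φ.exists_rep
  refine exists_eq_star_mul_self ?_ fun ρ w => ?_
  · rw [IsSelfAdjoint, ← sliceLeft_star, star_mul, star_star]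
  · rw [← inner_rep_left π ρ hξ, Rep.inner_star_mul_self (rep π ρ)]
    exact Complex.zero_le_real.mpr (sq_nonneg _)

theorem exists_sliceRight_star_mul_self (ψ : State B) (x : SpatialTensor A B) :
    ∃ z, sliceRight ψ (star x * x) = star z * z := by
  obtain ⟨ρ, ξ, -, hξ⟩ := ψ.exists_rep
  refine exists_eq_star_mul_self ?_ fun π w => ?_
  · rw [IsSelfAdjoint, ← sliceRight_star, star_mul, star_star]
  · rw [← inner_rep_right π ρ hξ, Rep.inner_star_mul_self (rep π ρ)]
    exact Complex.zero_le_real.mpr (sq_nonneg _)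

/-- The vector state of a unit vector in a representation. -/
noncomputable def Rep.vectorState (π : Rep A) (ξ : π.H) (hξ : ‖ξ‖ = 1) : State A where
  toCLM := (π.vec ξ ξ).mkContinuous 1 fun a => by
    refine (norm_inner_le_norm _ _).trans ?_
    rw [hξ, one_mul, one_mul]
    refine ((π.hom a).le_opNorm _).trans ?_
    rw [hξ, mul_one]
    exact NonUnitalStarAlgHom.norm_apply_le _ a
  nonneg' a := by
    change 0 ≤ ⟪ξ, π.hom (star a * a) ξ⟫_ℂ
    rw [Rep.inner_star_mul_self]
    exact Complex.zero_le_real.mpr (sq_nonneg _)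
  map_one' := by
    change ⟪ξ, π.hom 1 ξ⟫_ℂ = 1
    rw [map_one, one_apply_eq_self, inner_self_eq_norm_sq_to_K, hξ]
    simp

theorem Rep.vectorState_apply (π : Rep A) (ξ : π.H) (hξ : ‖ξ‖ = 1) (a : A) :
    π.vectorState ξ hξ a = ⟪ξ, π.hom a ξ⟫_ℂ := rfl

/-- An element of `A ⊗ B` is zero if it annihilates all elementary tensors of unit vectors in all
representations `π ⊗ ρ`. -/
theorem eq_zero_of_forall_unit (x : SpatialTensor A B)
    (h : ∀ (π : Rep A) (ρ : Rep B) (v : π.H) (w : ρ.H), ‖v‖ = 1 → ‖w‖ = 1 →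
      (rep π ρ).hom x (HilbertTensor.incl (v ⊗ₜ w)) = 0) : x = 0 := by
  rw [← norm_le_zero_iff]
  refine SpatialTensor.norm_le_of_forall_rep x le_rfl fun π ρ => ?_
  rw [norm_le_zero_iff]
  refine HilbertTensor.ext_clm fun v w => ?_
  rw [zero_apply]
  rcases eq_or_ne v 0 with rfl | hv
  · rw [TensorProduct.zero_tmul, map_zero, map_zero]
  rcases eq_or_ne w 0 with rfl | hw
  · rw [TensorProduct.tmul_zero, map_zero, map_zero]
  have hv' : (‖v‖ : ℂ) ≠ 0 := by simpa using hv
  have hw' : (‖w‖ : ℂ) ≠ 0 := by simpa using hw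
  have h1 := h π ρ ((‖v‖ : ℂ)⁻¹ • v) ((‖w‖ : ℂ)⁻¹ • w)
    (norm_smul_inv_norm hv) (norm_smul_inv_norm hw)
  rw [← TensorProduct.smul_tmul', TensorProduct.tmul_smul, map_smul, map_smul, map_smul, map_smul,
    smul_eq_zero, smul_eq_zero] at h1
  simpa [hv', hw'] using h1

/-- The product of faithful states is faithful on the spatial tensor product. -/
theorem State.IsFaithful.tensor {φ : State A} {ψ : State B} (hφ : φ.IsFaithful)
    (hψ : ψ.IsFaithful) {x : SpatialTensor A B} (hx : φ.tensor ψ (star x * x) = 0) : x = 0 := by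
  obtain ⟨z, hz⟩ := exists_sliceLeft_star_mul_self φ x
  -- The slice `(φ ⊗ id)(x*x)` is positive and `ψ`-null, so faithfulness of `ψ` kills it.
  have hz0 : sliceLeft φ (star x * x) = 0 := by
    rw [State.tensor_apply, hz] at hx
    rw [hz, hψ z hx, mul_zero]
  refine eq_zero_of_forall_unit x fun π ρ v w hv hw => ?_
  obtain ⟨y, hy⟩ := exists_sliceRight_star_mul_self (ρ.vectorState w hw) x
  have hy0 : sliceRight (ρ.vectorState w hw) (star x * x) = 0 := by
    -- By Fubini the positive element `(id ⊗ ω_w)(x*x)`, with `ω_w` the vector state of `w`, is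
    -- `φ`-null, so faithfulness of `φ` kills it too.
    have h1 := apply_sliceLeft φ (ρ.vectorState w hw) (star x * x)
    rw [hz0, map_zero, hy] at h1
    rw [hy, hφ y h1.symm, mul_zero]
  -- The vanishing compression computes `‖(π ⊗ ρ)(x)(v ⊗ w)‖²`.
  have h2 := inner_rep_right π ρ (ρ.vectorState_apply w hw · |>.symm) v v (star x * x)
  rw [hy0, map_zero, zero_apply, inner_zero_right, Rep.inner_star_mul_self (rep π ρ)] at h2
  simpa using h2

end FaithfulTensor

end CQG
namespace CQG

open SpatialTensor

/-! ### Faithful idempotent states are Haar states -/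

section FaithfulIdempotent

variable {A : Type u} [CStarAlgebra A] {Δ : A →⋆ₐ[ℂ] SpatialTensor A A}

/-- States separate the points of a C⋆-algebra. -/
theorem eq_of_forall_state {x y : A} (h : ∀ ω : State A, ω x = ω y) : x = y := by
  rw [← sub_eq_zero, ← norm_le_zero_iff]
  refine CQG.norm_le_of_forall_rep _ le_rfl fun ρ v => ?_
  rw [zero_mul, norm_le_zero_iff]
  have h0 : ∀ w : ρ.H, ⟪w, ρ.hom (x - y) w⟫_ℂ = 0 := fun w => by
    rcases eq_or_ne w 0 with rfl | hw
    · rw [inner_zero_left]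
    have h1 := h (ρ.vectorState ((‖w‖ : ℂ)⁻¹ • w) (norm_smul_inv_norm hw))
    have hw' : (‖w‖ : ℂ) ≠ 0 := by simpa using hw
    rw [← sub_eq_zero, ← map_sub, Rep.vectorState_apply, map_smul, inner_smul_left,
      inner_smul_right] at h1
    simpa [hw, hw', inner_sub_right] using h1
  -- Polarization over `ℂ`: an operator whose quadratic form vanishes is zero.
  have h2 : ((ρ.hom (x - y) : ρ.H →L[ℂ] ρ.H) : ρ.H →ₗ[ℂ] ρ.H) = 0 :=
    (inner_map_self_eq_zero _).mp fun w => by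
      rw [← inner_conj_symm]; exact (congrArg _ (h0 w)).trans (map_zero _)
  exact LinearMap.congr_fun h2 v

theorem IsIdempotentState.apply_sliceRight {h : State A} (hh : IsIdempotentState Δ h) (a : A) :
    h (sliceRight h (Δ a)) = h a := (apply_sliceLeft h h _).symm.trans (hh a)

theorem IsIdempotentState.apply_sliceLeft {h : State A} (hh : IsIdempotentState Δ h) (a : A) :
    h (sliceLeft h (Δ a)) = h a := hh a

theorem comul_sliceRight (ω : State A) (z : SpatialTensor A A) :
    Δ (sliceRight ω z) = sliceRight ω (map Δ (StarAlgHom.id ℂ A) z) :=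
  (sliceRight_map ω ω Δ _ (fun _ => rfl) z).symm

theorem comul_sliceLeft (ω : State A) (z : SpatialTensor A A) :
    Δ (sliceLeft ω z) = sliceLeft ω (map (StarAlgHom.id ℂ A) Δ z) :=
  (sliceLeft_map ω ω _ Δ (fun _ => rfl) z).symm

/-- Convolution from the right by an idempotent state is an idempotent map. -/
theorem sliceRight_comul_sliceRight_comul (hΔ : IsCompactQuantumGroup Δ) {h : State A}
    (hh : IsIdempotentState Δ h) (a : A) :
    sliceRight h (Δ (sliceRight h (Δ a))) = sliceRight h (Δ a) :=
  eq_of_forall_state fun ω => by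
    -- Tested on `ω`, the identity reads `(ω ∗ h) ∗ h = ω ∗ (h ∗ h) = ω ∗ h` for convolution.
    rw [comul_sliceRight, ← CQG.apply_sliceLeft ω h, ← sliceRight_sliceLeft_assoc, hΔ.coassoc,
      ← comul_sliceLeft, hh.apply_sliceRight, CQG.apply_sliceLeft]

/-- Convolution from the left by an idempotent state is an idempotent map. -/
theorem sliceLeft_comul_sliceLeft_comul (hΔ : IsCompactQuantumGroup Δ) {h : State A}
    (hh : IsIdempotentState Δ h) (a : A) :
    sliceLeft h (Δ (sliceLeft h (Δ a))) = sliceLeft h (Δ a) :=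
  eq_of_forall_state fun ω => by
    rw [comul_sliceLeft, CQG.apply_sliceLeft h ω, ← hΔ.coassoc, sliceRight_sliceLeft_assoc,
      ← comul_sliceRight, hh.apply_sliceLeft, ← CQG.apply_sliceLeft]

/-- Let `e` be fixed by `(id ⊗ h)Δ`. Each of the four terms in the expansion of `|Δ(e) - e ⊗ 1|²`
contributes `±h(e*e)` under `h ⊗ h`, and they cancel. Faithfulness of `h ⊗ h` concludes. -/
theorem comul_eq_inl (hΔ : IsCompactQuantumGroup Δ) {h : State A} (hh : IsIdempotentState Δ h)
    (hf : h.IsFaithful) (a : A) : Δ (sliceRight h (Δ a)) = inl (sliceRight h (Δ a)) := by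
  have hE := sliceRight_comul_sliceRight_comul hΔ hh a
  -- From here on `e` enters only as a fixed point.
  obtain ⟨e, he⟩ : ∃ e, sliceRight h (Δ a) = e := ⟨_, rfl⟩
  rw [he] at hE ⊢
  rw [← sub_eq_zero]
  refine hf.tensor hf ?_
  have h1 : star (Δ e - inl e) * (Δ e - inl e) = Δ (star e * e) - star (inl (star e) * Δ e)
      - inl (star e) * Δ e + inl (star e * e) := by
    rw [star_sub, star_mul, ← map_star Δ, ← map_star inl, ← map_star inl, star_star, map_mul,
      map_mul]
    noncomm_ring
  rw [h1, State.tensor_apply, CQG.apply_sliceLeft, map_add, map_sub, map_sub, map_add, map_sub,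
    map_sub, hh.apply_sliceRight, sliceRight_star, sliceRight_inl_mul, hE,
    inl_apply (star e * e), sliceRight_tmul, h.apply_one, one_smul, star_mul, star_star]
  ring

theorem comul_eq_inr (hΔ : IsCompactQuantumGroup Δ) {h : State A} (hh : IsIdempotentState Δ h)
    (hf : h.IsFaithful) (a : A) : Δ (sliceLeft h (Δ a)) = inr (sliceLeft h (Δ a)) := by
  have hE := sliceLeft_comul_sliceLeft_comul hΔ hh a
  obtain ⟨e, he⟩ : ∃ e, sliceLeft h (Δ a) = e := ⟨_, rfl⟩
  rw [he] at hE ⊢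
  rw [← sub_eq_zero]
  refine hf.tensor hf ?_
  have h1 : star (Δ e - inr e) * (Δ e - inr e) = Δ (star e * e) - star (inr (star e) * Δ e)
      - inr (star e) * Δ e + inr (star e * e) := by
    rw [star_sub, star_mul, ← map_star Δ, ← map_star inr, ← map_star inr, star_star, map_mul,
      map_mul]
    noncomm_ring
  rw [h1, State.tensor_apply, map_add, map_sub, map_sub, map_add, map_sub,
    map_sub, hh.apply_sliceLeft, sliceLeft_star, sliceLeft_inr_mul, hE,
    inr_apply (star e * e), sliceLeft_tmul, h.apply_one, one_smul, star_mul, star_star]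
  ring

/-- A faithful idempotent state on a compact quantum group is the Haar state. -/
theorem isHaarState_of_isFaithful (hΔ : IsCompactQuantumGroup Δ) {h : State A}
    (hh : IsIdempotentState Δ h) (hf : h.IsFaithful) : IsHaarState Δ h := by
  -- With `E = (id ⊗ h)Δ`, slicing the outer legs gives `E((h ⊗ id)((c ⊗ 1)Δ(a))) = (h ⊗ id)((c ⊗
  -- 1)Δ(E(a)))`. Since `Δ(E(a)) = E(a) ⊗ 1`, this is the scalar `h(cE(a))`.
  have hR : ∀ c a : A, sliceRight h (Δ (sliceLeft h (inl c * Δ a)))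
      = h (sliceLeft h (inl c * Δ a)) • (1 : A) := fun c a => by
    have e1 := sliceRight_sliceLeft_assoc h h
      (inl (inl c) * map Δ (StarAlgHom.id ℂ A) (Δ a))
    have e2 : assoc (inl (inl c) * map Δ (StarAlgHom.id ℂ A) (Δ a))
        = map (StarAlgHom.id ℂ A) Δ (inl c * Δ a) := by
      rw [map_mul, map_mul, hΔ.coassoc, map_inl]
      simp only [inl_apply, assoc_tmul]
      rfl
    rw [e2, ← comul_sliceLeft, sliceRight_inl_mul, ← comul_sliceRight, comul_eq_inl hΔ hh hf,
      ← map_mul, inl_apply (c * _), sliceLeft_tmul] at e1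
    rw [e1, CQG.apply_sliceLeft, sliceRight_inl_mul]
  have hL : ∀ c a : A, sliceLeft h (Δ (sliceRight h (inr c * Δ a)))
      = h (sliceRight h (inr c * Δ a)) • (1 : A) := fun c a => by
    have e1 := sliceRight_sliceLeft_assoc h h
      (inr c * map Δ (StarAlgHom.id ℂ A) (Δ a))
    have e2 : assoc (inr c * map Δ (StarAlgHom.id ℂ A) (Δ a))
        = inr (inr c) * map (StarAlgHom.id ℂ A) Δ (Δ a) := by
      rw [map_mul, hΔ.coassoc, inr_apply c, assoc_tmul_eq, map_one, one_mul]
    have e3 : inr c * map Δ (StarAlgHom.id ℂ A) (Δ a)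
        = map Δ (StarAlgHom.id ℂ A) (inr c * Δ a) := by
      rw [map_mul, map_inr]; rfl
    rw [e2, e3, ← comul_sliceRight, sliceLeft_inr_mul, ← comul_sliceLeft, comul_eq_inr hΔ hh hf,
      ← map_mul, inr_apply (c * _), sliceRight_tmul] at e1
    rw [← e1, ← CQG.apply_sliceLeft, sliceLeft_inr_mul]
  intro a
  constructor
  -- By density `hL` extends from slices of `(1 ⊗ A)Δ(A)` to slices of all tensors, and `a` is the
  -- slice of `a ⊗ 1`.
  · have h0 := clm_eq_zero_of_dense hΔ.dense_right
      (((sliceLeft h).comp ⟨(Δ : A →ₗ[ℂ] SpatialTensor A A), continuous_hom Δ⟩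
        - (h.toCLM).smulRight (1 : A)).comp (sliceRight h)) (by
          rintro _ ⟨c, b, rfl⟩
          exact sub_eq_zero.mpr (hL c b)) (inl a)
    have h1 : sliceRight h (inl a : SpatialTensor A A) = a := by
      rw [inl_apply, sliceRight_tmul, h.apply_one, one_smul]
    rw [ContinuousLinearMap.comp_apply, h1] at h0
    exact sub_eq_zero.mp h0
  · have h0 := clm_eq_zero_of_dense hΔ.dense_left
      (((sliceRight h).comp ⟨(Δ : A →ₗ[ℂ] SpatialTensor A A), continuous_hom Δ⟩
        - (h.toCLM).smulRight (1 : A)).comp (sliceLeft h)) (by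
          rintro _ ⟨c, b, rfl⟩
          exact sub_eq_zero.mpr (hR c b)) (inr a)
    have h1 : sliceLeft h (inr a : SpatialTensor A A) = a := by
      rw [inr_apply, sliceLeft_tmul, h.apply_one, one_smul]
    rw [ContinuousLinearMap.comp_apply, h1] at h0
    exact sub_eq_zero.mp h0

end FaithfulIdempotent

end CQG
namespace CQG

open SpatialTensor

/-! ### Null spaces of states and cyclic representations -/

section NullSpace

variable {A : Type u} [CStarAlgebra A] (φ : State A)

theorem nullSpace_add {a b : A} (ha : a ∈ nullSpace φ) (hb : b ∈ nullSpace φ) :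
    a + b ∈ nullSpace φ := by
  change φ (star (a + b) * (a + b)) = 0
  rw [mul_add, map_add, φ.mul_eq_zero ha, φ.mul_eq_zero hb, add_zero]

theorem nullSpace_mul_left (c : A) {a : A} (ha : a ∈ nullSpace φ) : c * a ∈ nullSpace φ := by
  change φ (star (c * a) * (c * a)) = 0
  rw [← mul_assoc, φ.mul_eq_zero ha]

theorem nullSpace_zero : (0 : A) ∈ nullSpace φ := by
  change φ (star (0 : A) * 0) = 0
  rw [mul_zero, map_zero]

theorem exists_ideal_eq_nullSpace : ∃ I : Ideal A, (I : Set A) = nullSpace φ :=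
  ⟨{ carrier := nullSpace φ
     add_mem' := nullSpace_add φ
     zero_mem' := nullSpace_zero φ
     smul_mem' := fun c _ ha => nullSpace_mul_left φ c ha }, rfl⟩

theorem nullSpace_mul_right (hs : ∀ a ∈ nullSpace φ, star a ∈ nullSpace φ) {a : A} (c : A)
    (ha : a ∈ nullSpace φ) : a * c ∈ nullSpace φ := by
  have h := hs _ (nullSpace_mul_left φ (star c) (hs a ha))
  rwa [star_mul, star_star, star_star] at h

/-- A two-sided null space contains `aa*` along with `a`, and Cauchy–Schwarz against `1` gives
`φ(aa*) = 0`. Conversely, adjoints turn left multiplication into right multiplication. -/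
theorem exists_twoSidedIdeal_iff :
    (∃ I : TwoSidedIdeal A, (I : Set A) = nullSpace φ) ↔
      ∀ a ∈ nullSpace φ, star a ∈ nullSpace φ := by
  constructor
  · rintro ⟨I, hI⟩ a ha
    have h1 : a * star a ∈ nullSpace φ := by
      rw [← hI] at ha ⊢
      exact I.mul_mem_right _ _ ha
    change φ (star (star a) * star a) = 0
    have h2 := φ.mul_eq_zero h1 1
    rw [one_mul] at h2
    rwa [star_star]
  · intro hs
    refine ⟨TwoSidedIdeal.mk' (nullSpace φ) (nullSpace_zero φ) (nullSpace_add φ)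
      (fun {x} hx => ?_) (fun {x y} hy => nullSpace_mul_left φ x hy)
      (fun {x y} hx => nullSpace_mul_right φ hs y hx), ?_⟩
    · have := nullSpace_mul_left φ (-1) hx
      rwa [neg_one_mul] at this
    · ext x; simp

/-- The GNS representation, with its cyclic vector. -/
theorem State.exists_cyclic_rep : ∃ (π : Rep A) (ξ : π.H), ‖ξ‖ = 1 ∧
    (∀ a, ⟪ξ, π.hom a ξ⟫_ℂ = φ a) ∧ DenseRange fun a => π.hom a ξ := by
  let _ : PartialOrder A := CStarAlgebra.spectralOrder A
  have _ : StarOrderedRing A := CStarAlgebra.spectralOrderedRing A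
  let f : A →ₚ[ℂ] ℂ := PositiveLinearMap.mk₀ (φ.toCLM : A →ₗ[ℂ] ℂ) fun x hx => by
    obtain ⟨b, rfl⟩ := CStarAlgebra.nonneg_iff_eq_star_mul_self.mp hx
    exact φ.nonneg' b
  have hf : ∀ a, f a = φ a := fun _ => rfl
  let ξ : f.GNS := ((f.toPreGNS 1 : f.PreGNS) : Completion f.PreGNS)
  have happ : ∀ a, f.gnsStarAlgHom a ξ = ((f.toPreGNS a : f.PreGNS) : Completion f.PreGNS) :=
    fun a => by
      change f.gnsNonUnitalStarAlgHom a ξ = _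
      rw [f.gnsNonUnitalStarAlgHom_apply_coe]
      simp
  have key : ∀ a, ⟪ξ, f.gnsStarAlgHom a ξ⟫_ℂ = φ a := fun a => by
    rw [happ, Completion.inner_coe, f.preGNS_inner_def]
    simp [hf]
  refine ⟨⟨f.GNS, f.gnsStarAlgHom⟩, ξ, ?_, key, ?_⟩
  · have h1 := key 1
    rw [map_one, one_apply_eq_self, inner_self_eq_norm_sq_to_K, φ.apply_one,
      RCLike.ofReal_eq_complex_ofReal] at h1
    have h3 : ‖ξ‖ ^ 2 = 1 := by exact_mod_cast h1
    exact (pow_eq_one_iff_of_nonneg (norm_nonneg _) two_ne_zero).mp h3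
  · change DenseRange fun a => f.gnsStarAlgHom a ξ
    simp only [happ]
    exact Completion.denseRange_coe.comp f.toPreGNS.surjective.denseRange
      (Completion.continuous_coe _)

end NullSpace

/-! ### Quotient C⋆-algebras as images of ⋆-homomorphisms -/

section Quotient

variable {A B : Type u} [CStarAlgebra A] [CStarAlgebra B]

/-- Each element in the range of a ⋆-homomorphism has a preimage of the same norm. -/
theorem exists_preimage_norm_le (σ : A →⋆ₐ[ℂ] B) (a : A) : ∃ b, σ b = σ a ∧ ‖b‖ ≤ ‖σ a‖ := by
  rcases (norm_nonneg (σ a)).eq_or_lt with h0 | h0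
  · exact ⟨0, by rw [map_zero, eq_comm, ← norm_eq_zero, ← h0], by simp⟩
  set r := ‖σ a‖ with hr
  have : Nontrivial B := ⟨σ a, 0, norm_pos_iff.mp h0⟩
  -- Cut-off at height `r`: `f = 1` on `[0, r²]`, which contains the spectrum of `σ(a)*σ(a)`, while
  -- `f(t)√t ≤ r` for all `t ≥ 0`. Thus `a·f(a*a)` has the same image as `a` and norm at most `r`.
  obtain ⟨f, hf⟩ : ∃ f : ℝ → ℝ, ∀ t, f t = r / max r √t := ⟨_, fun _ => rfl⟩
  have hmax : ∀ t, 0 < max r √t := fun t => lt_max_of_lt_left h0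
  have hfc : Continuous f := (funext hf : f = _) ▸ continuous_const.div (by fun_prop) fun t => (hmax t).ne'
  have hsa : IsSelfAdjoint (star a * a) := IsSelfAdjoint.star_mul_self a
  set u := cfc f (star a * a) with hu
  have hus : star u = u := (cfc_predicate f (star a * a) : IsSelfAdjoint u)
  refine ⟨a * u, ?_, ?_⟩
  · have h1 : σ u = 1 := by
      rw [hu, StarAlgHomClass.map_cfc (S := ℂ) σ f (star a * a) hfc.continuousOn (continuous_hom σ)
        hsa (hsa.map σ), map_mul, map_star]
      rw [← cfc_one ℝ (star (σ a) * σ a)]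
      refine cfc_congr fun t ht => ?_
      have ht2 : t ≤ r ^ 2 := by
        have := spectrum.norm_le_norm_of_mem ht
        rw [CStarRing.norm_star_mul_self, ← sq] at this
        exact (le_abs_self t).trans this
      rw [Pi.one_apply, hf, max_eq_left (Real.sqrt_le_iff.mpr ⟨h0.le, ht2⟩), div_self h0.ne']
    rw [map_mul, h1, mul_one]
  · have h2 : star (a * u) * (a * u) = cfc (fun t => f t * t * f t) (star a * a) := by
      rw [cfc_mul (fun t => f t * t) f _ (hfc.mul continuous_id).continuousOn hfc.continuousOn,
        cfc_mul f (fun t => t) _ hfc.continuousOn continuousOn_id,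
        cfc_id' ℝ (star a * a) hsa, ← hu,
        star_mul, hus]
      simp only [mul_assoc]
    refine abs_le_of_sq_le_sq' ?_ h0.le |>.2
    rw [sq, ← CStarRing.norm_star_mul_self, h2]
    refine norm_cfc_le (sq_nonneg r) fun t ht => ?_
    have ht0 : 0 ≤ t := spectrum_star_mul_self_nonneg t ht
    have hm := hmax t
    have e : f t * t * f t = r ^ 2 * (√t / max r √t) ^ 2 := by
      have := Real.sq_sqrt ht0
      rw [hf, div_pow, this]
      field_simp
    rw [e, Real.norm_of_nonneg (by positivity)]
    refine mul_le_of_le_one_right (sq_nonneg r) (pow_le_one₀ (by positivity) ?_)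
    exact (div_le_one hm).mpr (le_max_right _ _)

/-- Norm-controlled preimages allow a convergent series in the range to be lifted term by term, so
completeness of `A` closes the range. -/
theorem isClosed_range (σ : A →⋆ₐ[ℂ] B) : IsClosed (σ.range : Set B) := by
  let g : NormedAddGroupHom A B := (σ : A →+ B).mkNormedAddGroupHom 1 fun a => by
    rw [one_mul]; exact NonUnitalStarAlgHom.norm_apply_le σ a
  let K : AddSubgroup B := (σ : A →+ B).range
  have hK : g.SurjectiveOnWith K 1 := by
    rintro _ ⟨a, rfl⟩
    obtain ⟨b, hb, hb'⟩ := exists_preimage_norm_le σ a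
    exact ⟨b, hb, by rwa [one_mul]⟩
  have hK' := controlled_closure_of_complete one_pos one_pos hK
  have : closure (K : Set B) ⊆ K := fun x hx => by
    obtain ⟨a, ha, -⟩ := hK' x hx
    exact ⟨a, ha⟩
  have h2 : (σ.range : Set B) = K := rfl
  rw [h2]
  exact isClosed_of_closure_subset this

/-- Contractivity bounds `‖σ(a)‖` by the distance. A preimage `b` of `σ(a)` with `‖b‖ ≤ ‖σ(a)‖`
gives the kernel element `a - b` at distance `‖b‖` from `a`. -/
theorem norm_eq_infDist_ker (σ : A →⋆ₐ[ℂ] B) {N : Set A} (hN : ∀ a, σ a = 0 ↔ a ∈ N) (a : A) :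
    ‖σ a‖ = Metric.infDist a N := by
  refine le_antisymm ?_ ?_
  · refine (Metric.le_infDist ⟨0, (hN 0).mp (map_zero σ)⟩).mpr fun {y} hy => ?_
    rw [dist_eq_norm]
    have : σ a = σ (a - y) := by rw [map_sub, (hN y).mpr hy, sub_zero]
    rw [this]
    exact NonUnitalStarAlgHom.norm_apply_le σ _
  · obtain ⟨b, hb, hb'⟩ := exists_preimage_norm_le σ a
    have h1 : a - b ∈ N := (hN _).mp (by rw [map_sub, hb, sub_self])
    refine (Metric.infDist_le_dist_of_mem h1).trans ?_
    rwa [dist_eq_norm, sub_sub_cancel]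

/-- If `N_φ` is selfadjoint, then `A / N_φ` is a C⋆-algebra and `φ` descends to a state on it. -/
theorem State.exists_quotient (φ : State A) (hs : ∀ a ∈ nullSpace φ, star a ∈ nullSpace φ) :
    ∃ (Q : Type u) (_ : CStarAlgebra Q) (j : A →⋆ₐ[ℂ] Q) (h : State Q),
      IsQuotientMap j (nullSpace φ) ∧ ∀ a, φ a = h (j a) := by
  obtain ⟨π, ξ, hξ, hπ, hd⟩ := φ.exists_cyclic_rep
  have hker : ∀ a, π.hom a = 0 ↔ a ∈ nullSpace φ := fun a => by
    constructor
    · intro ha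
      change φ (star a * a) = 0
      rw [← hπ, map_mul, ha, mul_zero, zero_apply, inner_zero_right]
    · intro ha
      refine DFunLike.coe_injective (hd.equalizer (π.hom a).continuous continuous_zero ?_)
      funext b
      -- Here selfadjointness enters: `ab` stays in the null space, so `π(a)` kills every `π(b)ξ`,
      -- and these are dense.
      have h1 : ⟪ξ, π.hom (star (a * b) * (a * b)) ξ⟫_ℂ = 0 :=
        (hπ _).trans (nullSpace_mul_right φ hs b ha)
      rw [Rep.inner_star_mul_self] at h1
      simpa using h1
  have hcl : IsClosed (π.hom.range : Set (π.H →L[ℂ] π.H)) := isClosed_range π.hom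
  let h : State π.hom.range :=
    Rep.vectorState ⟨π.H, π.hom.range.subtype⟩ ξ hξ
  have hk : ∀ a, π.hom.rangeRestrict a = 0 ↔ a ∈ nullSpace φ := fun a => by
    rw [← hker, ← Subtype.coe_inj]; rfl
  exact ⟨π.hom.range, inferInstance, π.hom.rangeRestrict, h,
    ⟨fun ⟨_, a, ha⟩ => ⟨a, Subtype.ext ha⟩, hk, norm_eq_infDist_ker _ hk⟩, fun a => (hπ a).symm⟩

/-- A ⋆-homomorphism vanishing on the kernel of a surjective ⋆-homomorphism factors through it. -/
theorem exists_lift {C : Type u} [CStarAlgebra C] {j : A →⋆ₐ[ℂ] B}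
    (hj : Function.Surjective j) (f : A →⋆ₐ[ℂ] C) (hf : ∀ a, j a = 0 → f a = 0) :
    ∃ g : B →⋆ₐ[ℂ] C, ∀ a, g (j a) = f a := by
  let s := Function.surjInv hj
  have hs : ∀ b, j (s b) = b := Function.surjInv_eq hj
  -- The value of `f` does not depend on the preimage, so the arbitrary section `s` yields a
  -- homomorphism.
  have key : ∀ {a a'}, j a = j a' → f a = f a' := fun {a a'} h => by
    rw [← sub_eq_zero, ← map_sub]
    exact hf _ (by rw [map_sub, h, sub_self])
  exact ⟨{ toFun := fun b => f (s b)
           map_one' := by rw [← map_one f]; exact key (by rw [hs, map_one])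
           map_mul' := fun x y => by rw [← map_mul]; exact key (by rw [map_mul, hs, hs, hs])
           map_zero' := by rw [← map_zero f]; exact key (by rw [hs, map_zero])
           map_add' := fun x y => by rw [← map_add]; exact key (by rw [map_add, hs, hs, hs])
           commutes' := fun c => by
             rw [← AlgHomClass.commutes f c]; exact key (by rw [hs, AlgHomClass.commutes])
           map_star' := fun x => by rw [← map_star f]; exact key (by rw [map_star, hs, hs]) },
    fun a => key (hs _)⟩

end Quotient

end CQG
namespace CQG

open SpatialTensor

/-! ### The quotient quantum subgroup and its uniqueness -/

section Main

variable {A B : Type u} [CStarAlgebra A] [CStarAlgebra B] {Δ : A →⋆ₐ[ℂ] SpatialTensor A A}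

namespace SpatialTensor

theorem denseRange_map {j : A →⋆ₐ[ℂ] B} (hj : Function.Surjective j) : DenseRange (map j j) := by
  have hc : IsClosed {x | x ∈ closure (Set.range (map j j))} := isClosed_closure
  refine fun x => induction_tmul (p := fun x => x ∈ closure (Set.range (map j j))) hc
    (fun b c => ?_) (fun x y hx hy => ?_) x
  · obtain ⟨a, rfl⟩ := hj b
    obtain ⟨a', rfl⟩ := hj c
    exact subset_closure ⟨tmul a a', map_tmul j j a a'⟩
  · refine map_mem_closure₂ continuous_add hx hy ?_
    rintro _ ⟨x, rfl⟩ _ ⟨y, rfl⟩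
    exact ⟨x + y, map_add _ x y⟩

end SpatialTensor

/-- Since `j ⊗ j` is continuous with dense range, it maps dense subspaces to dense ones. Both
density axioms pass to the quotient in this way. -/
theorem dense_span_map {j : A →⋆ₐ[ℂ] B} (hj : Function.Surjective j)
    {s : Set (SpatialTensor A A)} {t : Set (SpatialTensor B B)}
    (hs : Dense (Submodule.span ℂ s : Set (SpatialTensor A A))) (hst : ∀ x ∈ s, map j j x ∈ t) :
    Dense (Submodule.span ℂ t : Set (SpatialTensor B B)) := by
  refine ((denseRange_map hj).dense_image (continuous_hom _) hs).mono ?_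
  rintro _ ⟨x, hx, rfl⟩
  induction hx using Submodule.span_induction with
  | mem x hx => exact Submodule.subset_span (hst x hx)
  | zero => simp
  | add x y _ _ hx hy => rw [map_add]; exact Submodule.add_mem _ hx hy
  | smul c x _ hx => rw [map_smul]; exact Submodule.smul_mem _ _ hx

/-- A quotient of a compact quantum group to which the coproduct descends is a compact quantum
group. -/
theorem IsCompactQuantumGroup.of_surjective (hΔ : IsCompactQuantumGroup Δ) {j : A →⋆ₐ[ℂ] B}
    (hj : Function.Surjective j) {Γ : B →⋆ₐ[ℂ] SpatialTensor B B}
    (hΓ : ∀ a, Γ (j a) = map j j (Δ a)) : IsCompactQuantumGroup Γ where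
  coassoc b := by
    obtain ⟨a, rfl⟩ := hj b
    have h1 : Γ.comp j = (map j j).comp Δ := StarAlgHom.ext hΓ
    have h2 : (StarAlgHom.id ℂ B).comp j = j.comp (StarAlgHom.id ℂ A) := rfl
    rw [hΓ, map_map, map_map, h1, h2, ← map_map, ← map_map, assoc_map, hΔ.coassoc]
  dense_right := dense_span_map hj hΔ.dense_right (by
    rintro _ ⟨a, b, rfl⟩
    exact ⟨j a, j b, by rw [map_mul, map_tmul, map_one, hΓ]⟩)
  dense_left := dense_span_map hj hΔ.dense_left (by
    rintro _ ⟨a, b, rfl⟩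
    exact ⟨j a, j b, by rw [map_mul, map_tmul, map_one, hΓ]⟩)

theorem State.tensor_map {φ : State A} {h : State B} {j : A →⋆ₐ[ℂ] B} (hj : ∀ a, φ a = h (j a))
    (z : SpatialTensor A A) : h.tensor h (map j j z) = φ.tensor φ z := by
  rw [State.tensor_apply, sliceLeft_map φ h j j hj, ← hj, State.tensor_apply]

/-- The null space of a Haar idempotent is selfadjoint. -/
theorem IsHaarIdempotent.star_mem_nullSpace {φ : State A} (hφ : IsHaarIdempotent Δ φ) {a : A}
    (ha : a ∈ nullSpace φ) : star a ∈ nullSpace φ := by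
  obtain ⟨S, h, hh, hj⟩ := hφ
  have h1 : h (star (S.j a) * S.j a) = 0 := by
    rw [← map_star, ← map_mul, ← hj]; exact ha
  change φ (star (star a) * star a) = 0
  rw [hj, map_mul, map_star, map_star]
  -- The Haar state result is applied to `x = j(a)*`.
  exact haar_star_mul_eq_zero S.isCompactQuantumGroup hh (by rwa [star_star])

/-- An idempotent state with selfadjoint null space is induced by the quantum subgroup
`A / N_φ`. -/
theorem exists_quantumSubgroup (hΔ : IsCompactQuantumGroup Δ) {φ : State A}
    (hφ : IsIdempotentState Δ φ) (hs : ∀ a ∈ nullSpace φ, star a ∈ nullSpace φ) :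
    ∃ (S : QuantumSubgroup Δ) (h : State S.B),
      IsQuotientMap S.j (nullSpace φ) ∧ S.Induces h φ ∧ h.IsFaithful := by
  obtain ⟨Q, _, j, h, hq, hj⟩ := φ.exists_quotient hs
  have hf : h.IsFaithful := fun b hb => by
    obtain ⟨a, rfl⟩ := hq.surjective b
    rw [← map_star, ← map_mul, ← hj] at hb
    exact (hq.ker a).mpr hb
  -- The coproduct descends: for `j(a) = 0`, idempotency gives `(h ⊗ h)(|(j ⊗ j)Δ(a)|²) = φ(a*a) =
  -- 0`, and `h ⊗ h` is faithful.
  obtain ⟨Γ, hΓ⟩ := exists_lift hq.surjective ((map j j).comp Δ) (fun a ha => by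
    refine hf.tensor hf ?_
    rw [StarAlgHom.comp_apply, ← map_star, ← map_star, ← map_mul, ← map_mul,
      State.tensor_map hj, hφ]
    exact (hq.ker a).mp ha)
  have hΓ' := hΔ.of_surjective hq.surjective hΓ
  have hh : IsIdempotentState Γ h := fun b => by
    obtain ⟨a, rfl⟩ := hq.surjective b
    rw [hΓ, StarAlgHom.comp_apply, State.tensor_map hj, hφ, hj]
  exact ⟨⟨Q, Γ, hΓ', j, hq.surjective, hΓ⟩, h, hq, ⟨isHaarState_of_isFaithful hΓ' hh hf, hj⟩, hf⟩

/-- The kernel is thus determined by `φ` alone, and this is what makes the subgroup unique. -/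
theorem QuantumSubgroup.Induces.j_eq_zero_iff {φ : State A} {S : QuantumSubgroup Δ}
    {h : State S.B} (hi : S.Induces h φ) (hf : h.IsFaithful) (a : A) :
    S.j a = 0 ↔ a ∈ nullSpace φ := by
  change _ ↔ φ (star a * a) = 0
  rw [hi.2, map_mul, map_star]
  exact ⟨fun ha => by rw [ha, mul_zero, map_zero], hf _⟩

/-- Two quantum subgroups with the same kernel are isomorphic. -/
theorem QuantumSubgroup.exists_equiv {S S' : QuantumSubgroup Δ}
    (hker : ∀ a, S.j a = 0 ↔ S'.j a = 0) :
    ∃ Θ : S.B ≃⋆ₐ[ℂ] S'.B, (∀ a, Θ (S.j a) = S'.j a) ∧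
      ∀ b, S'.comul (Θ b) =
        map (Θ : S.B →⋆ₐ[ℂ] S'.B) (Θ : S.B →⋆ₐ[ℂ] S'.B) (S.comul b) := by
  obtain ⟨f, hf⟩ := exists_lift S.surjective S'.j fun a => (hker a).mp
  obtain ⟨g, hg⟩ := exists_lift S'.surjective S.j fun a => (hker a).mpr
  let Θ : S.B ≃⋆ₐ[ℂ] S'.B := StarAlgEquiv.ofStarAlgHom f g
    (StarAlgHom.ext fun b => by
      obtain ⟨a, rfl⟩ := S.surjective b
      change g (f (S.j a)) = S.j a
      rw [hf, hg])
    (StarAlgHom.ext fun b => by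
      obtain ⟨a, rfl⟩ := S'.surjective b
      change f (g (S'.j a)) = S'.j a
      rw [hg, hf])
  have hΘ : ∀ a, Θ (S.j a) = S'.j a := hf
  refine ⟨Θ, hΘ, fun b => ?_⟩
  obtain ⟨a, rfl⟩ := S.surjective b
  have h1 : (Θ : S.B →⋆ₐ[ℂ] S'.B).comp S.j = S'.j := StarAlgHom.ext hΘ
  rw [hΘ, S'.comul_j, S.comul_j, map_map, h1]

end Main

end CQG

theorem mainTheorem4 {A : Type u} [CStarAlgebra A] (Δ : A →⋆ₐ[ℂ] CQG.SpatialTensor A A)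
    (hΔ : CQG.IsCompactQuantumGroup Δ) (φ : CQG.State A) (hφ : CQG.IsIdempotentState Δ φ) :
    -- `φ` is a Haar idempotent iff the left ideal `N_φ` is two-sided, iff it is selfadjoint
    (∃ I : Ideal A, (I : Set A) = CQG.nullSpace φ) ∧
    (CQG.IsHaarIdempotent Δ φ ↔ ∃ I : TwoSidedIdeal A, (I : Set A) = CQG.nullSpace φ) ∧
    ((∃ I : TwoSidedIdeal A, (I : Set A) = CQG.nullSpace φ) ↔
      ∀ a ∈ CQG.nullSpace φ, star a ∈ CQG.nullSpace φ) ∧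
    -- in that case `φ` comes from the quantum subgroup `A / N_φ`, and every quantum subgroup with
    -- faithful Haar state that induces `φ` is isomorphic to it
    (CQG.IsHaarIdempotent Δ φ → ∃ (S : CQG.QuantumSubgroup Δ) (h : CQG.State S.B),
      CQG.IsQuotientMap S.j (CQG.nullSpace φ) ∧ S.Induces h φ ∧ h.IsFaithful ∧
      ∀ (S' : CQG.QuantumSubgroup Δ) (h' : CQG.State S'.B), S'.Induces h' φ → h'.IsFaithful →
        ∃ Θ : S.B ≃⋆ₐ[ℂ] S'.B, (∀ a, Θ (S.j a) = S'.j a) ∧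
          ∀ b, S'.comul (Θ b) =
            CQG.SpatialTensor.map (Θ : S.B →⋆ₐ[ℂ] S'.B) (Θ : S.B →⋆ₐ[ℂ] S'.B) (S.comul b)) := by
  -- Selfadjointness is the hub: both other conditions are compared with it.
  have key : CQG.IsHaarIdempotent Δ φ ↔ ∀ a ∈ CQG.nullSpace φ, star a ∈ CQG.nullSpace φ :=
    ⟨fun h a ha => h.star_mem_nullSpace ha, fun hs => by
      obtain ⟨S, h, -, hi, -⟩ := CQG.exists_quantumSubgroup hΔ hφ hs
      exact ⟨S, h, hi⟩⟩
  refine ⟨CQG.exists_ideal_eq_nullSpace φ, key.trans (CQG.exists_twoSidedIdeal_iff φ).symm,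
    CQG.exists_twoSidedIdeal_iff φ, fun hH => ?_⟩
  obtain ⟨S, h, hq, hi, hf⟩ := CQG.exists_quantumSubgroup hΔ hφ (key.mp hH)
  exact ⟨S, h, hq, hi, hf, fun S' h' hi' hf' => CQG.QuantumSubgroup.exists_equiv fun a =>
    (hq.ker a).trans (hi'.j_eq_zero_iff hf' a).symm⟩
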